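/- Conventions. Graphs are undirected, may have parallel edges and loops, and have nonnegative edge lengths. Edge sets of tours and solutions are multisets, lengths $\ell(\cdot)$ are counted with multiplicity, and a tour is a closed walk (possibly a single vertex). For $t\ge 0$, a path $P$ is $t$-short in a graph $B$ if $\mathrm{dist}_P(x,y)\le(1+t)\,\mathrm{dist}_B(x,y)$ for all vertices $x,y$ of $P$. Bricks. Let $G$ be a graph, $\epsilon>0$ and $\kappa\ge 1$ real numbers. A brick $B$ of $G$ is a finite connected plane graph, with boundary $\partial B$ (the facial walk of one of its faces), obtained by cutting $G$ along $\partial B$. That is, every vertex and edge of $B$ is a copy of one of $G$, with the same incidences and lengths; the vertices not on $\partial B$ and the edges not in $\partial B$ have only one copy; and every edge of $G$ at a vertex of $B$ not on $\partial B$ belongs to $B$. Further: 1. $\partial B$ is the union of four paths in clockwise order $W,N,E,S$ (where $N$ and $S$ are read from left to right, from $W$ to $E$; the paths may consist of one vertex). 2. $N$ is $0$-short in $B$, and every proper subpath of $S$ is $\epsilon$-short in $B$. 3. There are an integer $0\le k\le\kappa$ and vertices $s_0,s_1,\dots,s_k$, ordered from left to right along $S$, with $s_0$ and $s_k$ the two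 ends of $S$, such that $\mathrm{dist}_S(x,s_i)<\epsilon\,\mathrm{dist}_B(x,N)$ for every $i<k$ and every vertex $x$ of $S$ strictly between $s_i$ and $s_{i+1}$. Crossings. An edge of $B$ is strictly inside $B$ if it is not an edge of $\partial B$. For a tour $T$ in $G$, a crossing of $T$ with $P\in\{E,W\}$ is a maximal cyclic subwalk of $T$ that runs along $P$ (possibly a single vertex, possibly an end of $P$) such that the edge of $T$ just before it or the edge of $T$ just after it is strictly inside $B$ and is attached to $P$ there. So a visit to $P$ from inside $B$ that turns back inside counts as one crossing. Joining vertices. A joining vertex of a subgraph $H'$ of $B$ with $\partial B$ is a vertex of $\partial B$ that is an endpoint of an edge of $H'$ that is not in $\partial B$. Theorem (TSP Property of Bricks). Let $B$ be a brick of $G$ with boundary $W\cup N\cup E\cup S$, and let $T$ be a tour in $G$ that crosses $E$ at most twice and $W$ at most twice. Let $H$ be the intersection of $T$ with $B$, taken either as the multiset of all edges of $T$ that belong to $B$, or as the multiset of those edges of $T$ that are strictly inside $B$. In either case there is a finite multiset $H'$ of edges of $B$ such that (T1) $H'$ has at most $6\kappa+14$ joining vertices with $\partial B$; (T2) $\ell(H')\le(1+3\epsilon)\,\ell(H)$;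 (T3) there is a tour in $G$ that uses each edge at most as often as it occurs in the multiset $(T\setminus H)\cup H'$, and that visits every vertex of $G$ that lies on $\partial B$ and is visited by $T$. -/

import Mathlib

open scoped NNReal ENNReal

/-- An undirected graph with nonnegative edge lengths; parallel edges and loops are allowed.
Every edge is given by its two opposite darts `d` and `rev d`, where `d` leads from `tail d`
to `tail (rev d)`. -/
structure WGraph (V D : Type*) where
  tail : D → V
  rev : D → D
  rev_rev : ∀ d, rev (rev d) = d
  rev_ne : ∀ d, rev d ≠ d
  len : D → ℝ≥0
  len_rev : ∀ d, len (rev d) = len d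

namespace WGraph

variable {V D : Type*}

def head (G : WGraph V D) (d : D) : V := G.tail (G.rev d)

/-- The list of darts `L` is a walk from `u` to `v`. -/
def IsWalk (G : WGraph V D) : V → List D → V → Prop
  | u, [], v => u = v
  | u, d :: L, v => G.tail d = u ∧ G.IsWalk (G.head d) L v

/-- The vertices visited, in order, by a walk `L` that starts at `u`. -/
def support (G : WGraph V D) (u : V) (L : List D) : List V := u :: L.map G.head

/-- A path is a walk without repeated vertices. -/
def IsPath (G : WGraph V D) (u : V) (L : List D) (v : V) : Prop :=
  G.IsWalk u L v ∧ (G.support u L).Nodup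

/-- The total length of a multiset of edges; each edge is represented by one of its darts. -/
def length (G : WGraph V D) (M : Multiset D) : ℝ≥0 := (M.map G.len).sum

/-- The distance of two vertices: the infimum of the lengths of the walks joining them. -/
noncomputable def dist (G : WGraph V D) (u v : V) : ℝ≥0∞ :=
  ⨅ (L : List D) (_ : G.IsWalk u L v), (G.length L : ℝ≥0∞)

/-- The distance from a vertex to a set of vertices. -/
noncomputable def distTo (G : WGraph V D) (u : V) (A : Set V) : ℝ≥0∞ :=
  ⨅ v ∈ A, G.dist u v

/-- The path `P` is `t`-short: each of its subpaths, from `x` to `y` say, has length at most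
`(1 + t)` times the distance from `x` to `y` in the graph. -/
def IsShort (G : WGraph V D) (t : ℝ≥0) (P : List D) : Prop :=
  ∀ Q, Q <:+: P → ∀ x y, G.IsWalk x Q y →
    (G.length Q : ℝ≥0∞) ≤ (1 + (t : ℝ≥0∞)) * G.dist x y

/-- The multiplicity of the edge `{d, rev d}` in a multiset of edges. -/
noncomputable def mult (G : WGraph V D) (M : Multiset D) (d : D) : ℕ :=
  open Classical in M.count d + M.count (G.rev d)

/-- The edge `{d, rev d}` belongs to the walk `P`. -/
def OnWalk (G : WGraph V D) (P : List D) (d : D) : Prop := d ∈ P ∨ G.rev d ∈ P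

/-- The joining vertices of `H` with a nonempty walk `P`: the vertices of `P` that are endpoints
of an edge of `H` that is not an edge of `P`. -/
def joiningVertices (G : WGraph V D) (H : Multiset D) (P : List D) : Set V :=
  {v | (∃ d ∈ P, G.tail d = v ∨ G.head d = v) ∧
    ∃ d ∈ H, ¬ G.OnWalk P d ∧ (G.tail d = v ∨ G.head d = v)}

/-- The reversal of dart directions, as a permutation. -/
def revPerm (G : WGraph V D) : Equiv.Perm D := ⟨G.rev, G.rev, G.rev_rev, G.rev_rev⟩

/-- The face permutation of the rotation `rot`: it maps each dart to the next one on the face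
along which it runs. -/
def facePerm (G : WGraph V D) (rot : Equiv.Perm D) : Equiv.Perm D := G.revPerm.trans rot

/-- The permutation `rot` of the darts is a planar embedding of a finite connected graph:
it permutes cyclically the darts that leave each vertex, and `#V - #E + #F = 2`. -/
def IsPlanarEmbedding (G : WGraph V D) (rot : Equiv.Perm D) : Prop :=
  (∀ d e, rot.SameCycle d e ↔ G.tail d = G.tail e) ∧
  (∀ u v, ∃ L, G.IsWalk u L v) ∧
  2 * Nat.card V + 2 * Nat.card (Quotient (Equiv.Perm.SameCycle.setoid (G.facePerm rot))) =
    Nat.card D + 4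

/-- `L` is the facial walk of a face of the embedding `rot`. -/
def IsFacialWalk (G : WGraph V D) (rot : Equiv.Perm D) (L : List D) : Prop :=
  L ≠ [] ∧ L.Nodup ∧ L.map (G.facePerm rot) = L.rotate 1

end WGraph

/-- A brick of the graph `G`. It is a plane graph `graph`, cut out of `G` along the facial walk
that bounds it. Since the facial walk may use a vertex or an edge of `G` more than once, cutting
can produce several copies of it on the boundary of the brick; `vmap` and `dmap` tell of which
vertex and edge of `G` each vertex and edge of the brick is a copy. -/
structure Brick {V D : Type*} (G : WGraph V D) (VB DB : Type*) (ε : ℝ≥0) (κ : ℝ) where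
  graph : WGraph VB DB
  rot : Equiv.Perm DB
  planar : graph.IsPlanarEmbedding rot
  /-- The corners. -/
  (sw nw ne se : VB)
  /-- The sides: `W` runs upwards, `N` and `S` from left to right, `E` downwards. -/
  (W N E S : List DB)
  W_path : graph.IsPath sw W nw
  N_path : graph.IsPath nw N ne
  E_path : graph.IsPath ne E se
  S_path : graph.IsPath sw S se
  boundary_facial : graph.IsFacialWalk rot (W ++ N ++ E ++ (S.map graph.rev).reverse)
  vmap : VB → V
  dmap : DB → D
  vmap_tail : ∀ d, vmap (graph.tail d) = G.tail (dmap d)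
  dmap_rev : ∀ d, dmap (graph.rev d) = G.rev (dmap d)
  dmap_len : ∀ d, G.len (dmap d) = graph.len d
  /-- Edges strictly inside the brick are not duplicated. -/
  dmap_inner : ∀ d, ¬ graph.OnWalk (W ++ N ++ E ++ (S.map graph.rev).reverse) d →
    ∀ e, dmap e = dmap d → e = d
  /-- Vertices strictly inside the brick are not duplicated. -/
  vmap_inner : ∀ v, (∀ d ∈ W ++ N ++ E ++ (S.map graph.rev).reverse, graph.tail d ≠ v) →
    ∀ w, vmap w = vmap v → w = v
  /-- At a vertex strictly inside the brick, all edges of `G` belong to the brick. -/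
  star_inner : ∀ v, (∀ d ∈ W ++ N ++ E ++ (S.map graph.rev).reverse, graph.tail d ≠ v) →
    ∀ e, G.tail e = vmap v → ∃ d, graph.tail d = v ∧ dmap d = e
  N_short : graph.IsShort 0 N
  S_short : ∀ Q, Q <:+: S → Q ≠ S → graph.IsShort ε Q
  /-- The vertices `s_0, …, s_k` of `S` are given by their positions on `S`; `s_0` and `s_k` are
  the two ends of `S`. -/
  k : ℕ
  k_le : (k : ℝ) ≤ κ
  s : ℕ → ℕ
  s_mono : Monotone s
  s_zero : s 0 = 0
  s_last : s k = S.length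
  /-- Every vertex `x` of `S` strictly between `s_i` and `s_(i+1)` satisfies
  `dist_S(x, s_i) < ε * dist_B(x, N)`. -/
  s_close : ∀ i < k, ∀ q, s i < q → q < s (i + 1) →
    ∀ x, (graph.support sw S)[q]? = some x →
      (graph.length ((S.take q).drop (s i) : List DB) : ℝ≥0∞) <
        ε * graph.distTo x {v | v ∈ graph.support nw N}

namespace Brick

variable {V D VB DB : Type*} {G : WGraph V D} {ε : ℝ≥0} {κ : ℝ}

/-- The boundary of the brick, in clockwise order `W`, `N`, `E`, `S`. -/
def boundary (B : Brick G VB DB ε κ) : List DB :=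
  B.W ++ B.N ++ B.E ++ (B.S.map B.graph.rev).reverse

/-- The edge of `d` lies strictly inside the brick. -/
def Inner (B : Brick G VB DB ε κ) (d : DB) : Prop := ¬ B.graph.OnWalk B.boundary d

/-- The vertices on the boundary of the brick. -/
def boundaryVertices (B : Brick G VB DB ε κ) : Set VB :=
  {v | ∃ d ∈ B.boundary, B.graph.tail d = v}

/-- The edges of `G` that belong to the brick (as a set of darts). -/
def edges (B : Brick G VB DB ε κ) : Set D := Set.range B.dmap

/-- The edges of `G` that lie strictly inside the brick. -/
def innerEdges (B : Brick G VB DB ε κ) : Set D := B.dmap '' {d | B.Inner d}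

/-- The number of times that the closed walk `T` of `G` crosses the side `P` of the brick, where
`P` starts at the vertex `p`. A crossing is a maximal subwalk of the cyclic walk `T` that runs
along `P` (possibly a single vertex) and that `T` enters from strictly inside the brick or leaves
to strictly inside the brick. It is counted at the index `i` of the last edge of `T` before it;
`m` is the number of edges that `T` uses on `P`, and `a` and `b` are the edges of `T` just before
and just after. In particular, a visit to `P` from inside that turns back counts. -/
noncomputable def crossings (B : Brick G VB DB ε κ) (T : List D) (p : VB) (P : List DB) : ℕ :=
  Set.ncard {i : ℕ | i < T.length ∧ ∃ (m : ℕ) (a b : D),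
    T[i]? = some a ∧ ¬ G.OnWalk (P.map B.dmap) a ∧
    (∀ j, 1 ≤ j → j ≤ m → ∃ c, T[(i + j) % T.length]? = some c ∧ G.OnWalk (P.map B.dmap) c) ∧
    T[(i + m + 1) % T.length]? = some b ∧ ¬ G.OnWalk (P.map B.dmap) b ∧
    ((∃ d, B.Inner d ∧ B.dmap d = a ∧ B.graph.head d ∈ B.graph.support p P) ∨
      (∃ d, B.Inner d ∧ B.dmap d = b ∧ B.graph.tail d ∈ B.graph.support p P))}

end Brick

/-! The tour enters the inside of the brick in excursions: subwalks that leave the boundary by an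
edge strictly inside and stop at their next boundary vertex. To build a new tour, only two
properties of the edge multiset matter: all degrees are even, and the vertices to be visited lie in
one component. So the excursions may be exchanged for any edges of the brick with the same degree
parities that still join the two ends of every excursion; Euler's theorem (`exists_euler_tour`) then
gives the tour. `Replaceable` records such an exchange with its length and joining vertices. It is
additive, so the excursions can be sorted by the sides on which they end.

Excursions that end on `E` or `W` are kept. Every crossing accounts for at most one entering and one
leaving dart, so there are at most four of them per side, hence at most 16 joining vertices. Of the
others, those with both ends on `N`, or both on `S`, are replaced by a subpath of that side, which
is short and has no joining vertices.

The excursions between `N` and `S` are grouped by the interval from `s i` to `s (i + 1)` that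
contains their end on `S` (`replaceable_interval`). In a group, the distance along `S` from `s i` to
an end is at most `ε` times the length of that excursion. The two excursions with outermost ends on
`N` are deleted in favour of the path of `N` between these ends; since `N` is 0-short, it costs at
most `1 + ε` times their length. This is repeated until at most two excursions, with four joining
vertices, remain (`exists_N_join`). A part of `S` starting at `s i`, with every edge used once or
twice, joins the ends on `S` and repairs their parities at a cost of at most `2ε` times one
excursion. Altogether the factor is `1 + 3ε`, and `16 + 4k ≤ 6κ + 14` because `k ≤ κ` and `1 ≤ κ`.
-/

namespace WGraph

variable {V D : Type*}

/-! ### Walks, lengths and distances -/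

theorem IsWalk.append {G : WGraph V D} {u v w : V} {L M : List D} (hL : G.IsWalk u L v)
    (hM : G.IsWalk v M w) : G.IsWalk u (L ++ M) w := by
  induction L generalizing u with
  | nil => cases hL; exact hM
  | cons d L ih => exact ⟨hL.1, ih hL.2⟩

theorem support_cons (G : WGraph V D) (u : V) (d : D) (L : List D) :
    G.support u (d :: L) = u :: G.support (G.head d) L := rfl

theorem mem_support_start (G : WGraph V D) (u : V) (L : List D) : u ∈ G.support u L :=
  List.mem_cons_self

theorem head_rev (G : WGraph V D) (d : D) : G.head (G.rev d) = G.tail d := by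
  simp [head, G.rev_rev]

theorem IsWalk.tail_mem {G : WGraph V D} {u v : V} {L : List D} (h : G.IsWalk u L v) {d : D}
    (hd : d ∈ L) : G.tail d ∈ G.support u L := by
  induction L generalizing u with
  | nil => simp at hd
  | cons e L ih =>
    rcases List.mem_cons.1 hd with rfl | hd
    · rw [h.1]; exact mem_support_start ..
    · exact List.mem_cons_of_mem _ (ih h.2 hd)

theorem head_mem_support (G : WGraph V D) (u : V) {L : List D} {d : D} (hd : d ∈ L) :
    G.head d ∈ G.support u L :=
  List.mem_cons_of_mem _ (List.mem_map_of_mem hd)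

theorem IsWalk.end_mem {G : WGraph V D} {u v : V} {L : List D} (h : G.IsWalk u L v) :
    v ∈ G.support u L := by
  induction L generalizing u with
  | nil => cases h; exact mem_support_start ..
  | cons e L ih => exact List.mem_cons_of_mem _ (ih h.2)

theorem IsWalk.mem_support_append {G : WGraph V D} {u v w : V} {L M : List D}
    (hL : G.IsWalk u L v) : w ∈ G.support u (L ++ M) ↔ w ∈ G.support u L ∨ w ∈ G.support v M := by
  induction L generalizing u with
  | nil => cases hL; simp [support]
  | cons d L ih =>
    rw [List.cons_append, support_cons, support_cons, List.mem_cons, List.mem_cons, ih hL.2]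
    tauto

theorem IsWalk.exists_split {G : WGraph V D} {u v w : V} {L : List D} (h : G.IsWalk u L v)
    (hw : w ∈ G.support u L) : ∃ L₁ L₂, L = L₁ ++ L₂ ∧ G.IsWalk u L₁ w ∧ G.IsWalk w L₂ v := by
  induction L generalizing u with
  | nil =>
    have : w = u := by simpa [support] using hw
    subst this
    exact ⟨[], [], rfl, rfl, h⟩
  | cons d L ih =>
    rcases List.mem_cons.1 hw with rfl | hw
    · exact ⟨[], d :: L, rfl, rfl, h⟩
    · obtain ⟨L₁, L₂, rfl, h1, h2⟩ := ih h.2 hw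
      exact ⟨d :: L₁, L₂, rfl, ⟨h.1, h1⟩, h2⟩

theorem IsWalk.take {G : WGraph V D} {u v : V} {L : List D} (h : G.IsWalk u L v) {q : ℕ} {y : V}
    (hy : (G.support u L)[q]? = some y) : G.IsWalk u (L.take q) y := by
  induction L generalizing u q with
  | nil =>
    cases q with
    | zero => simpa [support, IsWalk] using hy
    | succ q => simp [support] at hy
  | cons d L ih =>
    cases q with
    | zero => simpa [support, IsWalk] using hy
    | succ q => exact ⟨h.1, ih h.2 (by simpa [support_cons] using hy)⟩

theorem IsWalk.drop {G : WGraph V D} {u v : V} {L : List D} (h : G.IsWalk u L v) {p : ℕ} {x : V}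
    (hx : (G.support u L)[p]? = some x) : G.IsWalk x (L.drop p) v := by
  induction L generalizing u p with
  | nil =>
    cases p with
    | zero => cases h; simp [support] at hx; exact hx.symm
    | succ q => simp [support] at hx
  | cons d L ih =>
    cases p with
    | zero =>
      have : u = x := by simpa [support] using hx
      exact this ▸ h
    | succ q => exact ih h.2 (by simpa [support_cons] using hx)

theorem IsWalk.segment {G : WGraph V D} {u v : V} {L : List D} (h : G.IsWalk u L v) {p q : ℕ}
    {x y : V} (hx : (G.support u L)[p]? = some x) (hy : (G.support u L)[q]? = some y)
    (hpq : p ≤ q) : G.IsWalk x ((L.take q).drop p) y := by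
  refine (h.take hy).drop ?_
  rw [support, List.map_take, ← List.take_succ_cons, List.getElem?_take, if_pos (by omega)]
  exact hx

theorem length_add (G : WGraph V D) (M N : Multiset D) :
    G.length (M + N) = G.length M + G.length N := by simp [length]

theorem length_mono (G : WGraph V D) {M N : Multiset D} (h : M ≤ N) :
    G.length M ≤ G.length N := by
  obtain ⟨K, rfl⟩ := Multiset.le_iff_exists_add.1 h
  rw [length_add]
  exact le_self_add

theorem length_cons (G : WGraph V D) (d : D) (M : Multiset D) :
    G.length (d ::ₘ M) = G.len d + G.length M := by simp [length]

theorem IsWalk.dist_le {G : WGraph V D} {u v : V} {L : List D} (h : G.IsWalk u L v) :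
    G.dist u v ≤ G.length L := iInf₂_le L h

theorem IsWalk.reverse {G : WGraph V D} {u v : V} {L : List D} (h : G.IsWalk u L v) :
    G.IsWalk v (L.map G.rev).reverse u := by
  induction L generalizing u with
  | nil => cases h; rfl
  | cons d L ih =>
    rw [List.map_cons, List.reverse_cons]
    exact (ih h.2).append ⟨rfl, (G.head_rev d).trans h.1⟩

theorem length_map_rev (G : WGraph V D) (L : List D) :
    G.length ((L.map G.rev).reverse : List D) = G.length L := by
  rw [Multiset.coe_reverse]
  simp only [length, Multiset.map_coe, List.map_map]
  congr 2
  exact List.map_congr_left fun d _ => G.len_rev d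

theorem dist_comm (G : WGraph V D) (u v : V) : G.dist u v = G.dist v u := by
  have key : ∀ u v, G.dist u v ≤ G.dist v u := fun u v =>
    le_iInf₂ fun L hL => hL.reverse.dist_le.trans (by rw [length_map_rev])
  exact le_antisymm (key u v) (key v u)

theorem dist_triangle (G : WGraph V D) (u v w : V) : G.dist u w ≤ G.dist u v + G.dist v w := by
  unfold dist
  simp only [ENNReal.iInf_add, ENNReal.add_iInf]
  refine le_iInf₂ fun M hM => le_iInf₂ fun L hL => (hL.append hM).dist_le.trans ?_
  rw [← Multiset.coe_add, length_add, ENNReal.coe_add]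

/-! ### Degree parities, connectivity and Euler's theorem -/

/-- The vertices of odd degree in a multiset of edges, as a chain modulo 2. -/
noncomputable def oddChain (G : WGraph V D) (M : Multiset D) : V →₀ ZMod 2 :=
  (M.map fun d => Finsupp.single (G.tail d) 1 + Finsupp.single (G.head d) 1).sum

theorem oddChain_zero (G : WGraph V D) : G.oddChain 0 = 0 := by simp [oddChain]

theorem oddChain_add (G : WGraph V D) (M N : Multiset D) :
    G.oddChain (M + N) = G.oddChain M + G.oddChain N := by simp [oddChain]

theorem oddChain_cons (G : WGraph V D) (d : D) (M : Multiset D) :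
    G.oddChain (d ::ₘ M) =
      Finsupp.single (G.tail d) 1 + Finsupp.single (G.head d) 1 + G.oddChain M := by
  simp [oddChain]

theorem chain_add_self (f : V →₀ ZMod 2) : f + f = 0 := ZModModule.add_self f

theorem IsWalk.oddChain {G : WGraph V D} {u v : V} {L : List D} (h : G.IsWalk u L v) :
    G.oddChain L = Finsupp.single u 1 + Finsupp.single v 1 := by
  induction L generalizing u with
  | nil => cases h; simp [WGraph.oddChain, chain_add_self]
  | cons d L ih =>
    rw [← Multiset.cons_coe, oddChain_cons, ih h.2, h.1, add_assoc, ← add_assoc _ _ (Finsupp.single v 1),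
      chain_add_self, zero_add]

/-- Two vertices are joined by a walk whose edges belong to `M`. -/
def Reach (G : WGraph V D) (M : Multiset D) : V → V → Prop :=
  Relation.EqvGen fun a b => ∃ d ∈ M, G.tail d = a ∧ G.head d = b

theorem Reach.refl (G : WGraph V D) (M : Multiset D) (u : V) : G.Reach M u u :=
  Relation.EqvGen.refl u

theorem Reach.symm {G : WGraph V D} {M : Multiset D} {u v : V} (h : G.Reach M u v) :
    G.Reach M v u := Relation.EqvGen.symm _ _ h

theorem Reach.trans {G : WGraph V D} {M : Multiset D} {u v w : V} (h : G.Reach M u v)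
    (h' : G.Reach M v w) : G.Reach M u w := Relation.EqvGen.trans _ _ _ h h'

theorem reach_of_mem {G : WGraph V D} {M : Multiset D} {d : D} (h : d ∈ M) :
    G.Reach M (G.tail d) (G.head d) := Relation.EqvGen.rel _ _ ⟨d, h, rfl, rfl⟩

theorem Reach.mono {G : WGraph V D} {M N : Multiset D} {u v : V} (h : G.Reach M u v)
    (hMN : M ⊆ N) : G.Reach N u v :=
  Relation.EqvGen.mono (fun _ _ ⟨d, hd, h⟩ => ⟨d, hMN hd, h⟩) _ _ h

theorem IsWalk.reach {G : WGraph V D} {u v : V} {L : List D} (h : G.IsWalk u L v) :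
    G.Reach L u v := by
  induction L generalizing u with
  | nil => cases h; exact Reach.refl ..
  | cons d L ih =>
    rw [← h.1]
    exact (reach_of_mem (by simp)).trans ((ih h.2).mono fun e he => by simpa using Or.inr he)

theorem mult_add (G : WGraph V D) (M N : Multiset D) (d : D) :
    G.mult (M + N) d = G.mult M d + G.mult N d := by
  simp [mult]; omega

theorem mult_pos {G : WGraph V D} {M : Multiset D} {d : D} :
    0 < G.mult M d ↔ d ∈ M ∨ G.rev d ∈ M := by
  classical
  simp only [mult, ← Multiset.count_pos]
  omega

theorem mult_singleton_rev (G : WGraph V D) (d e : D) :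
    G.mult {G.rev d} e = G.mult {d} e := by
  classical
  have h1 : e = G.rev d ↔ G.rev e = d :=
    ⟨fun h => h ▸ G.rev_rev d, fun h => h ▸ (G.rev_rev e).symm⟩
  have h2 : G.rev e = G.rev d ↔ e = d :=
    ⟨fun h => by rw [← G.rev_rev e, h, G.rev_rev], fun h => h ▸ rfl⟩
  simp only [mult, Multiset.count_singleton, h1, h2]
  omega

theorem oddChain_apply_eq_zero {G : WGraph V D} {M : Multiset D} {v : V}
    (h : ∀ d ∈ M, G.tail d ≠ v ∧ G.head d ≠ v) : G.oddChain M v = 0 := by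
  classical
  induction M using Multiset.induction with
  | empty => simp [oddChain_zero]
  | cons d M ih =>
    have hd := h d (Multiset.mem_cons_self ..)
    rw [oddChain_cons, Finsupp.add_apply, Finsupp.add_apply,
      ih fun e he => h e (Multiset.mem_cons_of_mem he), Finsupp.single_apply, Finsupp.single_apply,
      if_neg hd.1, if_neg hd.2]
    simp

/-- Euler's theorem, for trails from `u` to `v`. -/
theorem exists_euler_trail (G : WGraph V D) (M : Multiset D) (u v : V)
    (hM : G.oddChain M = Finsupp.single u 1 + Finsupp.single v 1) :
    ∃ L, G.IsWalk u L v ∧ (∀ d, G.mult L d ≤ G.mult M d) ∧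
      ∀ d ∈ M, G.tail d ∈ G.support u L ↔ G.head d ∈ G.support u L := by
  classical
  induction hn : M.card using Nat.strong_induction_on generalizing M u v with
  | _ n ih =>
  by_cases hu : ∃ d ∈ M, G.tail d = u ∨ G.head d = u
  · obtain ⟨d, hd, hdu⟩ := hu
    obtain ⟨M', rfl⟩ := Multiset.exists_cons_of_mem hd
    obtain ⟨e, heu, hed, he⟩ : ∃ e, G.tail e = u ∧ (∀ f, G.mult {e} f = G.mult {d} f) ∧
        ((G.tail d = u ∧ G.head d = G.head e) ∨ (G.head d = u ∧ G.tail d = G.head e)) := by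
      rcases hdu with h | h
      · exact ⟨d, h, fun _ => rfl, Or.inl ⟨h, rfl⟩⟩
      · exact ⟨G.rev d, h, G.mult_singleton_rev d, Or.inr ⟨h, (G.head_rev d).symm⟩⟩
    have hM' : G.oddChain M' = Finsupp.single (G.head e) 1 + Finsupp.single v 1 := by
      have h1 : Finsupp.single (G.tail d) 1 + Finsupp.single (G.head d) 1 =
          (Finsupp.single u 1 + Finsupp.single (G.head e) 1 : V →₀ ZMod 2) := by
        rcases he with ⟨h, h'⟩ | ⟨h, h'⟩
        · rw [h, h']
        · rw [h, h', add_comm]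
      rw [oddChain_cons, h1, add_assoc] at hM
      have h2 := add_left_cancel hM
      rw [← h2, ← add_assoc, chain_add_self, zero_add]
    rw [Multiset.card_cons] at hn
    obtain ⟨L, hL, hLM, hLs⟩ := ih M'.card (by omega) M' _ _ hM' rfl
    set A := G.support (G.head e) L with hA
    set M₁ := M'.filter fun f => G.tail f ∈ A with hM₁
    set M₂ := M'.filter fun f => G.tail f ∉ A with hM₂
    have hsplit : M₁ + M₂ = M' := Multiset.filter_add_not _ _
    -- The vertex set `A` of the trail `L` is closed under the edges of `M'`, so each vertex meets
    -- only `M₁` or only `M₂`. Both `G.head e` and `v` lie in `A`, so `M₂` is even everywhere and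
    -- admits a closed trail at `u`, to be run before `e`.
    have hM₂0 : G.oddChain M₂ = Finsupp.single u 1 + Finsupp.single u 1 := by
      rw [chain_add_self]
      ext w
      rw [Finsupp.zero_apply]
      by_cases hw : w ∈ A
      · refine oddChain_apply_eq_zero fun f hf => ?_
        obtain ⟨hf, hfA⟩ := Multiset.mem_filter.1 hf
        exact ⟨fun h => hfA (h ▸ hw), fun h => hfA ((hLs f hf).2 (h ▸ hw))⟩
      · have h1 : G.oddChain M₁ w = 0 := by
          refine oddChain_apply_eq_zero fun f hf => ?_
          obtain ⟨hf, hfA⟩ := Multiset.mem_filter.1 hf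
          exact ⟨fun h => hw (h ▸ hfA), fun h => hw (h ▸ (hLs f hf).1 hfA)⟩
        have h2 := DFunLike.congr_fun hM' w
        rw [← hsplit, oddChain_add, Finsupp.add_apply, h1, zero_add, Finsupp.add_apply,
          Finsupp.single_apply, Finsupp.single_apply,
          if_neg fun h : G.head e = w => hw (h ▸ mem_support_start ..),
          if_neg fun h : v = w => hw (h ▸ hL.end_mem)] at h2
        simpa using h2
    obtain ⟨L', hL', hL'M, hL's⟩ := ih M₂.card
      (by have := congrArg Multiset.card hsplit; rw [Multiset.card_add] at this; omega)
      M₂ _ _ hM₂0 rfl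
    refine ⟨L' ++ e :: L, hL'.append ⟨heu, hL⟩, fun f => ?_, fun f hf => ?_⟩
    · rw [← Multiset.coe_add, ← Multiset.cons_coe, ← Multiset.singleton_add,
        ← Multiset.singleton_add, mult_add, mult_add, mult_add, hed]
      -- `L` uses only edges of `M₁`, so it does not compete with `L'` for edges.
      have hLM₁ : G.mult L f ≤ G.mult M₁ f := by
        by_cases hf : 0 < G.mult M₂ f
        · suffices ¬ 0 < G.mult L f by omega
          intro hfL
          have hfA : G.tail f ∈ A := by
            rcases mult_pos.1 hfL with h | h
            · exact hL.tail_mem h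
            · rw [← G.head_rev]; exact head_mem_support _ _ h
          rcases mult_pos.1 hf with h | h
          · exact (Multiset.mem_filter.1 h).2 hfA
          · obtain ⟨h1, h2⟩ := Multiset.mem_filter.1 h
            exact h2 ((hLs _ h1).2 (by rwa [G.head_rev]))
        · have h1 := hLM f
          rw [← hsplit, mult_add] at h1
          omega
      have h2 := hL'M f
      rw [← hsplit, mult_add]
      omega
    · rw [hL'.mem_support_append, hL'.mem_support_append, support_cons, ← hA]
      simp only [List.mem_cons]
      have hu' := mem_support_start G u L'
      have hA' : G.head e ∈ A := mem_support_start ..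
      rcases Multiset.mem_cons.1 hf with rfl | hf
      · rcases he with ⟨h, h'⟩ | ⟨h, h'⟩ <;> simp [h, h', hA']
      · have h1 := hLs f hf
        by_cases hfA : G.tail f ∈ A
        · simp [hfA, h1.1 hfA]
        · have h2 := hL's f (Multiset.mem_filter.2 ⟨hf, hfA⟩)
          have h3 : G.head f ∉ A := fun h => hfA (h1.2 h)
          simp only [hfA, h3, or_false]
          constructor
          · rintro (h | h)
            · exact Or.inl (h2.1 h)
            · exact Or.inl (h2.1 (h ▸ hu'))
          · rintro (h | h)
            · exact Or.inl (h2.2 h)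
            · exact Or.inl (h2.2 (h ▸ hu'))
  -- With no edge at `u`, the parity at `u` forces `v = u`, and the empty trail works.
  · push Not at hu
    have h0 := DFunLike.congr_fun hM u
    rw [oddChain_apply_eq_zero hu, Finsupp.add_apply, Finsupp.single_eq_same,
      Finsupp.single_apply] at h0
    have huv : v = u := by
      by_contra h
      simp [h] at h0
    subst huv
    refine ⟨[], rfl, fun d => by simp [mult], fun d hd => ?_⟩
    simp [support, hu d hd]

/-- The vertex set of the trail is closed under the edges of `M`, so it contains the component of
`u`. That all edges are traversed is not needed. -/
theorem exists_euler_tour (G : WGraph V D) {M : Multiset D} (hM : G.oddChain M = 0) (u : V) :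
    ∃ L, G.IsWalk u L u ∧ (∀ d, G.mult L d ≤ G.mult M d) ∧
      ∀ v, G.Reach M u v → v ∈ G.support u L := by
  obtain ⟨L, hL, hLM, hs⟩ := G.exists_euler_trail M u u (by rw [hM, chain_add_self])
  refine ⟨L, hL, hLM, fun v hv => ?_⟩
  have key : ∀ a b, G.Reach M a b → (a ∈ G.support u L ↔ b ∈ G.support u L) := by
    intro a b h
    induction h with
    | rel a b h => obtain ⟨d, hd, rfl, rfl⟩ := h; exact hs d hd
    | refl a => rfl
    | symm a b _ ih => exact ih.symm
    | trans a b c _ _ ih ih' => exact ih.trans ih'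
  exact (key u v hv).1 (mem_support_start ..)

/-- A multiset of vertices of a walk is, up to the parity at the start of the walk, the set of odd
vertices of a multiset that uses every edge of the walk once or twice. -/
theorem IsWalk.exists_join {G : WGraph V D} {u v : V} {L : List D} (h : G.IsWalk u L v)
    (Z : Multiset V) (hZ : ∀ z ∈ Z, z ∈ G.support u L) :
    ∃ J : Multiset D, (L : Multiset D) ≤ J ∧ J ≤ (L : Multiset D) + L ∧
      G.oddChain J = (Z.map fun z => Finsupp.single z 1).sum + Z.card • Finsupp.single u 1 := by
  classical
  induction L generalizing u Z with
  | nil =>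
    refine ⟨0, by simp, by simp, ?_⟩
    have : Z = Multiset.replicate Z.card u :=
      Multiset.eq_replicate_card.2 fun z hz => by simpa [support] using hZ z hz
    rw [oddChain_zero, this]
    simp only [Multiset.map_replicate, Multiset.sum_replicate, Multiset.card_replicate]
    rw [chain_add_self]
  | cons d L ih =>
    set Z₁ := Z.filter fun z => z = u with hZ₁
    set Z₂ := Z.filter fun z => ¬ z = u with hZ₂
    have hsplit : Z₁ + Z₂ = Z := Multiset.filter_add_not _ _
    obtain ⟨J, hJ, hJ', hodd⟩ := ih h.2 Z₂ fun z hz => by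
      obtain ⟨h1, h2⟩ := Multiset.mem_filter.1 hz
      exact (List.mem_cons.1 (hZ z h1)).resolve_left h2
    have h1 : Z₁ = Multiset.replicate Z₁.card u :=
      Multiset.eq_replicate_card.2 fun z hz => (Multiset.mem_filter.1 hz).2
    -- The first edge has to cancel the parity that the later vertices leave at its head, which
    -- fixes `n` modulo 2; taking 2 instead of 0 keeps the walk connected.
    obtain ⟨n, hn1, hn2, hn⟩ : ∃ n : ℕ, 1 ≤ n ∧ n ≤ 2 ∧ ∃ m, n + Z₂.card = 2 * m := by
      rcases Nat.even_or_odd' Z₂.card with ⟨m, hm | hm⟩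
      · exact ⟨2, by omega, by omega, m + 1, by omega⟩
      · exact ⟨1, by omega, by omega, m + 1, by omega⟩
    have hnsmul : ∀ f : V →₀ ZMod 2, n • f = Z₂.card • f := by
      intro f
      obtain ⟨m, hm⟩ := hn
      have : n • f + Z₂.card • f = 0 := by
        rw [← add_nsmul, hm, mul_nsmul, two_nsmul, chain_add_self, smul_zero]
      rw [eq_neg_of_add_eq_zero_left this, ZModModule.neg_eq_self]
    refine ⟨Multiset.replicate n d + J, ?_, ?_, ?_⟩
    · rw [← Multiset.cons_coe, ← Multiset.singleton_add]
      exact add_le_add ((Multiset.replicate_one d).symm ▸ Multiset.replicate_mono d hn1) hJ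
    · have : ((d :: L : List D) : Multiset D) + (d :: L : List D) =
          Multiset.replicate 2 d + ((L : Multiset D) + L) := by
        rw [← Multiset.cons_coe, ← Multiset.singleton_add]
        simp only [Multiset.replicate_succ, Multiset.replicate_zero]
        rw [add_add_add_comm]
        rfl
      rw [this]
      exact add_le_add (Multiset.replicate_mono d hn2) hJ'
    · have hrep : G.oddChain (Multiset.replicate n d) =
          n • (Finsupp.single u 1 + Finsupp.single (G.head d) 1) := by
        simp [WGraph.oddChain, h.1]
      rw [oddChain_add, hrep, hodd, hnsmul, ← hsplit, Multiset.map_add, Multiset.sum_add,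
        Multiset.card_add, h1]
      simp only [Multiset.map_replicate, Multiset.sum_replicate, Multiset.card_replicate]
      have e1 := chain_add_self (Z₂.card • (Finsupp.single (G.head d) 1 : V →₀ ZMod 2))
      have e2 := chain_add_self (Z₁.card • (Finsupp.single u 1 : V →₀ ZMod 2))
      rw [nsmul_add, add_nsmul]
      generalize Z₂.card • (Finsupp.single (G.head d) 1 : V →₀ ZMod 2) = a at *
      generalize Z₁.card • (Finsupp.single u 1 : V →₀ ZMod 2) = b at *
      generalize Z₂.card • (Finsupp.single u 1 : V →₀ ZMod 2) = c
      generalize (Z₂.map fun z => (Finsupp.single z 1 : V →₀ ZMod 2)).sum = f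
      calc c + a + (f + a) = f + c + (a + a) := by abel
        _ = f + c + (b + b) := by rw [e1, e2]
        _ = b + f + (b + c) := by abel

end WGraph

/-! ### Segments of a path between two of its vertices -/

namespace WGraph

variable {V D : Type*}

theorem IsWalk.end_unique {G : WGraph V D} {u v w : V} {L : List D} (h : G.IsWalk u L v)
    (h' : G.IsWalk u L w) : v = w := by
  induction L generalizing u with
  | nil => cases h; exact h'
  | cons d L ih => exact ih h.2 h'.2

open Classical in
/-- The part of the walk `L`, which starts at `u`, from the vertex `x` to the vertex `y`. -/
noncomputable def segment (G : WGraph V D) (u : V) (L : List D) (x y : V) : List D :=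
  (L.take ((G.support u L).idxOf y)).drop ((G.support u L).idxOf x)

open Classical in
/-- The position of a vertex on the walk `L` that starts at `u`. -/
noncomputable def pos (G : WGraph V D) (u : V) (L : List D) (x : V) : ℕ :=
  (G.support u L).idxOf x

theorem getElem?_pos (G : WGraph V D) {u : V} {L : List D} {x : V} (hx : x ∈ G.support u L) :
    (G.support u L)[G.pos u L x]? = some x := by
  classical
  exact List.getElem?_idxOf hx

theorem pos_le_length (G : WGraph V D) {u : V} {L : List D} {x : V} (hx : x ∈ G.support u L) :
    G.pos u L x ≤ L.length := by
  classical
  have := List.idxOf_lt_length_of_mem hx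
  simp only [support, List.length_cons, List.length_map] at this
  exact Nat.lt_succ_iff.1 this

theorem segment_eq (G : WGraph V D) (u : V) (L : List D) (x y : V) :
    G.segment u L x y = (L.take (G.pos u L y)).drop (G.pos u L x) := rfl

theorem IsWalk.isWalk_segment {G : WGraph V D} {u v x y : V} {L : List D} (h : G.IsWalk u L v)
    (hx : x ∈ G.support u L) (hy : y ∈ G.support u L) (hxy : G.pos u L x ≤ G.pos u L y) :
    G.IsWalk x (G.segment u L x y) y :=
  h.segment (G.getElem?_pos hx) (G.getElem?_pos hy) hxy

theorem segment_infix (G : WGraph V D) (u : V) (L : List D) (x y : V) :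
    G.segment u L x y <:+: L :=
  (List.drop_suffix _ _).isInfix.trans (List.take_prefix _ _).isInfix

theorem segment_sublist_of_le_right (G : WGraph V D) (u : V) (L : List D) {x y z : V}
    (h : G.pos u L y ≤ G.pos u L z) :
    (G.segment u L x y).Sublist (G.segment u L x z) :=
  List.Sublist.drop (List.take_sublist_take_left h) _

theorem IsWalk.reach_segment {G : WGraph V D} {u v x y z : V} {L : List D} (h : G.IsWalk u L v)
    (hx : x ∈ G.support u L) (hz : z ∈ G.support u L)
    (hxz : G.pos u L x ≤ G.pos u L z) (hzy : G.pos u L z ≤ G.pos u L y) :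
    G.Reach (G.segment u L x y) x z :=
  (h.isWalk_segment hx hz hxz).reach.mono fun _ hd =>
    (G.segment_sublist_of_le_right u L hzy).subset hd

theorem length_list_mono (G : WGraph V D) {L M : List D} (h : L.Sublist M) :
    G.length L ≤ G.length M :=
  G.length_mono (Multiset.coe_le.2 h.subperm)

end WGraph

/-! ### Links and their replacement -/

/-- Two vertices, together with a set of edges that joins them. -/
structure Link (VB DB : Type*) where
  fst : VB
  edges : Multiset DB
  snd : VB

namespace Link

variable {VB DB : Type*}

def flip (e : Link VB DB) : Link VB DB := ⟨e.snd, e.edges, e.fst⟩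

/-- The ends of a link, as a chain modulo 2. -/
noncomputable def ends (e : Link VB DB) : VB →₀ ZMod 2 :=
  Finsupp.single e.fst 1 + Finsupp.single e.snd 1

end Link

namespace Brick

variable {V D VB DB : Type*} {G : WGraph V D} {ε : ℝ≥0} {κ : ℝ}

/-- A link in the brick that has at most its ends as joining vertices. -/
structure IsLink (B : Brick G VB DB ε κ) (e : Link VB DB) : Prop where
  odd : B.graph.oddChain e.edges = e.ends
  reach : B.graph.Reach e.edges e.fst e.snd
  dist_le : B.graph.dist e.fst e.snd ≤ B.graph.length e.edges
  joining : B.graph.joiningVertices e.edges B.boundary ⊆ {e.fst, e.snd}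

theorem IsLink.flip {B : Brick G VB DB ε κ} {e : Link VB DB} (h : B.IsLink e) :
    B.IsLink e.flip where
  odd := h.odd.trans (add_comm _ _)
  reach := h.reach.symm
  dist_le := (B.graph.dist_comm _ _).trans_le h.dist_le
  joining := h.joining.trans (Set.pair_comm _ _).subset

theorem joiningVertices_add (B : Brick G VB DB ε κ) (H K : Multiset DB) :
    B.graph.joiningVertices (H + K) B.boundary =
      B.graph.joiningVertices H B.boundary ∪ B.graph.joiningVertices K B.boundary := by
  ext v
  simp only [WGraph.joiningVertices, Set.mem_union, Set.mem_ofPred_eq, Multiset.mem_add]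
  constructor
  · rintro ⟨h, d, hd | hd, h'⟩
    · exact Or.inl ⟨h, d, hd, h'⟩
    · exact Or.inr ⟨h, d, hd, h'⟩
  · rintro (⟨h, d, hd, h'⟩ | ⟨h, d, hd, h'⟩)
    · exact ⟨h, d, Or.inl hd, h'⟩
    · exact ⟨h, d, Or.inr hd, h'⟩

theorem joiningVertices_eq_empty (B : Brick G VB DB ε κ) {H : Multiset DB}
    (h : ∀ d ∈ H, ¬ B.Inner d) : B.graph.joiningVertices H B.boundary = ∅ := by
  ext v
  simp only [Set.mem_empty_iff_false, iff_false]
  rintro ⟨-, d, hd, h', -⟩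
  exact h d hd h'

theorem not_inner_of_mem {B : Brick G VB DB ε κ} {d : DB} (h : d ∈ B.boundary) : ¬ B.Inner d :=
  fun h' => h' (Or.inl h)

theorem mem_boundary {B : Brick G VB DB ε κ} {d : DB} :
    d ∈ B.boundary ↔ d ∈ B.W ∨ d ∈ B.N ∨ d ∈ B.E ∨ B.graph.rev d ∈ B.S := by
  have : d ∈ B.S.map B.graph.rev ↔ B.graph.rev d ∈ B.S := by
    rw [List.mem_map]
    exact ⟨fun ⟨e, he, h⟩ => by rwa [← h, B.graph.rev_rev], fun h => ⟨_, h, B.graph.rev_rev d⟩⟩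
  simp only [boundary, List.mem_append, List.mem_reverse, this, or_assoc]

theorem not_inner_N {B : Brick G VB DB ε κ} {d : DB} (h : d ∈ B.N) : ¬ B.Inner d :=
  not_inner_of_mem (mem_boundary.2 (by tauto))

theorem not_inner_S {B : Brick G VB DB ε κ} {d : DB} (h : d ∈ B.S) : ¬ B.Inner d :=
  fun h' => h' (Or.inr (mem_boundary.2 (by rw [B.graph.rev_rev]; tauto)))

/-- The links of `X` can be replaced by edges of the brick that join the same pairs of vertices,
have the same parities, are not much longer, and have at most `c` joining vertices. -/
def Replaceable (B : Brick G VB DB ε κ) (c : ℕ) (X : Multiset (Link VB DB)) : Prop :=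
  ∃ H : Multiset DB,
    B.graph.oddChain H = (X.map Link.ends).sum ∧
    (∀ e ∈ X, B.graph.Reach H e.fst e.snd) ∧
    B.graph.length H ≤ (1 + 3 * ε) * (X.map fun e => B.graph.length e.edges).sum ∧
    (B.graph.joiningVertices H B.boundary).ncard ≤ c

section Replaceable

variable {B : Brick G VB DB ε κ}

theorem replaceable_zero : B.Replaceable 0 0 :=
  ⟨0, by simp [WGraph.oddChain_zero], by simp, by simp [WGraph.length],
    by rw [joiningVertices_eq_empty B (by simp)]; simp⟩

theorem Replaceable.mono {c c' : ℕ} {X : Multiset (Link VB DB)} (h : B.Replaceable c X)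
    (hc : c ≤ c') : B.Replaceable c' X := by
  obtain ⟨H, h1, h2, h3, h4⟩ := h
  exact ⟨H, h1, h2, h3, h4.trans hc⟩

theorem Replaceable.add {c c' : ℕ} {X Y : Multiset (Link VB DB)}
    (hX : B.Replaceable c X) (hY : B.Replaceable c' Y) : B.Replaceable (c + c') (X + Y) := by
  obtain ⟨H, h1, h2, h3, h4⟩ := hX
  obtain ⟨K, k1, k2, k3, k4⟩ := hY
  refine ⟨H + K, by rw [WGraph.oddChain_add, h1, k1, Multiset.map_add, Multiset.sum_add],
    fun e he => ?_, ?_, ?_⟩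
  · rcases Multiset.mem_add.1 he with he | he
    · exact (h2 e he).mono (Multiset.subset_of_le (Multiset.le_add_right _ _))
    · exact (k2 e he).mono (Multiset.subset_of_le (Multiset.le_add_left _ _))
  · rw [WGraph.length_add, Multiset.map_add, Multiset.sum_add, mul_add]
    exact add_le_add h3 k3
  · rw [joiningVertices_add]
    exact (Set.ncard_union_le _ _).trans (add_le_add h4 k4)

theorem replaceable_of_forall {c : ℕ} {X : Multiset (Link VB DB)}
    (h : ∀ e ∈ X, B.Replaceable c {e}) : B.Replaceable (c * X.card) X := by
  induction X using Multiset.induction with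
  | empty => exact replaceable_zero
  | cons e X ih =>
    have := (h e (Multiset.mem_cons_self ..)).add
      (ih fun f hf => h f (Multiset.mem_cons_of_mem hf))
    rw [Multiset.singleton_add] at this
    rw [Multiset.card_cons, mul_add, mul_one, add_comm]
    exact this

/-- Parities, connectivity and length do not depend on the order of the two ends, so links may be
oriented at will, for instance from `S` to `N`. -/
theorem Replaceable.of_map {c : ℕ} {X : Multiset (Link VB DB)} {f : Link VB DB → Link VB DB}
    (hf : ∀ e, f e = e ∨ f e = e.flip) (h : B.Replaceable c (X.map f)) : B.Replaceable c X := by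
  obtain ⟨H, h1, h2, h3, h4⟩ := h
  have e1 : Link.ends ∘ f = Link.ends := by
    funext e
    rcases hf e with h | h
    · simp [h]
    · simp [h, Link.ends, Link.flip, add_comm]
  have e2 : (fun e : Link VB DB => B.graph.length e.edges) ∘ f =
      fun e => B.graph.length e.edges := by
    funext e
    rcases hf e with h | h <;> simp [h, Link.flip]
  rw [Multiset.map_map, e1] at h1
  rw [Multiset.map_map, e2] at h3
  refine ⟨H, h1, fun e he => ?_, h3, h4⟩
  have := h2 _ (Multiset.mem_map_of_mem f he)
  rcases hf e with h | h <;> rw [h] at this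
  · exact this
  · exact this.symm

theorem IsLink.ncard_joining_le {e : Link VB DB} (h : B.IsLink e) :
    (B.graph.joiningVertices e.edges B.boundary).ncard ≤ 2 :=
  (Set.ncard_le_ncard h.joining (by simp)).trans
    ((Set.ncard_insert_le _ _).trans (by rw [Set.ncard_singleton]))

theorem IsLink.replaceable {e : Link VB DB} (h : B.IsLink e) : B.Replaceable 2 {e} := by
  refine ⟨e.edges, by simp [h.odd], by simpa using h.reach, ?_, h.ncard_joining_le⟩
  rw [Multiset.map_singleton, Multiset.sum_singleton]
  exact le_mul_of_one_le_left' le_self_add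

/-- Joining vertices come only from edges off the boundary, so a walk along it is free of them. -/
theorem replaceable_of_walk {e : Link VB DB} {L : List DB}
    (hL : B.graph.IsWalk e.fst L e.snd) (hb : ∀ d ∈ L, ¬ B.Inner d)
    (hlen : B.graph.length L ≤ (1 + 3 * ε) * B.graph.length e.edges) :
    B.Replaceable 0 {e} := by
  refine ⟨L, by simp [hL.oddChain, Link.ends], by simpa using hL.reach, by simpa using hlen, ?_⟩
  rw [joiningVertices_eq_empty B (by simpa using hb)]
  simp

theorem Replaceable.of_flip {c : ℕ} {e : Link VB DB} (h : B.Replaceable c {e.flip}) :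
    B.Replaceable c {e} :=
  Replaceable.of_map (f := Link.flip) (fun _ => Or.inr rfl) (by simpa using h)

theorem IsLink.replaceable_N {e : Link VB DB} (h : B.IsLink e)
    (h1 : e.fst ∈ B.graph.support B.nw B.N) (h2 : e.snd ∈ B.graph.support B.nw B.N) :
    B.Replaceable 0 {e} := by
  wlog hle : B.graph.pos B.nw B.N e.fst ≤ B.graph.pos B.nw B.N e.snd generalizing e
  · exact (this h.flip h2 h1 (le_of_not_ge hle)).of_flip
  have hw := B.N_path.1.isWalk_segment h1 h2 hle
  have hinf := B.graph.segment_infix B.nw B.N e.fst e.snd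
  refine replaceable_of_walk hw (fun d hd => not_inner_N (hinf.subset hd)) ?_
  have := (B.N_short _ hinf _ _ hw).trans (mul_le_mul_right h.dist_le _)
  refine (show _ ≤ _ from ?_).trans (le_mul_of_one_le_left' le_self_add)
  simpa using this

/-- Only the right end of `S` has position `S.length`, and that corner belongs to `E`. -/
theorem pos_S_lt {x : VB} (hx : x ∈ B.graph.support B.sw B.S)
    (hxE : x ∉ B.graph.support B.ne B.E) : B.graph.pos B.sw B.S x < B.S.length := by
  by_contra hlt
  have h1 := B.S_path.1.take (B.graph.getElem?_pos hx)
  rw [List.take_of_length_le (not_lt.1 hlt)] at h1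
  exact hxE (B.S_path.1.end_unique h1 ▸ B.E_path.1.end_mem)

theorem IsLink.replaceable_S {e : Link VB DB} (h : B.IsLink e)
    (h1 : e.fst ∈ B.graph.support B.sw B.S) (h2 : e.snd ∈ B.graph.support B.sw B.S)
    (h3 : e.fst ∉ B.graph.support B.ne B.E) (h4 : e.snd ∉ B.graph.support B.ne B.E) :
    B.Replaceable 0 {e} := by
  wlog hle : B.graph.pos B.sw B.S e.fst ≤ B.graph.pos B.sw B.S e.snd generalizing e
  · exact (this h.flip h2 h1 h4 h3 (le_of_not_ge hle)).of_flip
  have hw := B.S_path.1.isWalk_segment h1 h2 hle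
  have hinf := B.graph.segment_infix B.sw B.S e.fst e.snd
  refine replaceable_of_walk hw (fun d hd => not_inner_S (hinf.subset hd)) ?_
  -- Only proper subpaths of `S` are known to be short; this one stops before the corner on `E`.
  have hne : B.graph.segment B.sw B.S e.fst e.snd ≠ B.S := by
    intro heq
    have := congrArg List.length heq
    rw [WGraph.segment_eq, List.length_drop, List.length_take] at this
    have := pos_S_lt h2 h4
    omega
  have := (B.S_short _ hinf hne _ List.infix_rfl _ _ hw).trans (mul_le_mul_right h.dist_le _)
  have h5 : B.graph.length (B.graph.segment B.sw B.S e.fst e.snd) ≤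
      (1 + ε) * B.graph.length e.edges := by exact_mod_cast this
  refine h5.trans (mul_le_mul_left ?_ _)
  gcongr
  exact le_mul_of_one_le_left' (by norm_num)

/-- The ends on `N` of a set of links can be joined, and their parities corrected, by paths of `N`
at the cost of all but two of the links. -/
theorem exists_N_join (n : ℕ) (X : Multiset (Link VB DB)) (hn : X.card = n)
    (hN : ∀ e ∈ X, e.snd ∈ B.graph.support B.nw B.N)
    (hd : ∀ a ∈ X, ∀ b ∈ X, B.graph.dist a.snd b.snd ≤
      ((1 + ε) * (B.graph.length a.edges + B.graph.length b.edges) : ℝ≥0)) :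
    ∃ (C R : Multiset (Link VB DB)) (J : Multiset DB), X = C + R ∧ C.card ≤ 2 ∧ Even R.card ∧
      (∀ d ∈ J, d ∈ B.N) ∧
      B.graph.oddChain J = (R.map fun e => Finsupp.single e.snd 1).sum ∧
      (∀ e ∈ X, ∃ c ∈ C, B.graph.Reach J e.snd c.snd) ∧
      B.graph.length J ≤ (1 + ε) * (R.map fun e => B.graph.length e.edges).sum := by
  classical
  induction n using Nat.strong_induction_on generalizing X with
  | _ n ih =>
  rcases le_or_gt n 2 with hn2 | hn2
  · exact ⟨X, 0, 0, by simp, by omega, by simp, by simp, by simp [WGraph.oddChain_zero],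
      fun e he => ⟨e, he, WGraph.Reach.refl ..⟩, by simp [WGraph.length]⟩
  set pos := B.graph.pos B.nw B.N with hpos
  -- The links with the leftmost and the rightmost end on `N` go to `R` and are paid for by the path
  -- between these ends, whose odd vertices are exactly these two; the remaining links are handled
  -- by induction.
  obtain ⟨a, ha, hamin⟩ := X.toFinset.exists_min_image (fun e => pos e.snd) (by
    rw [Finset.nonempty_iff_ne_empty, Ne, Multiset.toFinset_eq_empty]
    rintro rfl
    simp at hn; omega)
  rw [Multiset.mem_toFinset] at ha
  obtain ⟨X₁, rfl⟩ := Multiset.exists_cons_of_mem ha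
  rw [Multiset.card_cons] at hn
  obtain ⟨b, hb, hbmax⟩ := X₁.toFinset.exists_max_image (fun e => pos e.snd) (by
    rw [Finset.nonempty_iff_ne_empty, Ne, Multiset.toFinset_eq_empty]
    rintro rfl
    simp at hn; omega)
  rw [Multiset.mem_toFinset] at hb
  obtain ⟨X₂, rfl⟩ := Multiset.exists_cons_of_mem hb
  rw [Multiset.card_cons] at hn
  have hmem : ∀ e ∈ X₂, e ∈ a ::ₘ b ::ₘ X₂ := fun e he =>
    Multiset.mem_cons_of_mem (Multiset.mem_cons_of_mem he)
  have hb' : b ∈ a ::ₘ b ::ₘ X₂ := by simp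
  obtain ⟨C, R, J, hX, hC, hR, hJN, hodd, hreach, hlen⟩ := ih X₂.card (by omega) X₂ rfl
    (fun e he => hN e (hmem e he)) fun e he f hf => hd e (hmem e he) f (hmem f hf)
  have hle : ∀ e ∈ a ::ₘ b ::ₘ X₂, pos a.snd ≤ pos e.snd := fun e he =>
    hamin e (Multiset.mem_toFinset.2 he)
  have hge : ∀ e ∈ X₂, pos e.snd ≤ pos b.snd := fun e he =>
    hbmax e (Multiset.mem_toFinset.2 (Multiset.mem_cons_of_mem he))
  have hw := B.N_path.1.isWalk_segment (hN a ha) (hN b hb') (hle b hb')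
  have hinf := B.graph.segment_infix B.nw B.N a.snd b.snd
  set P := B.graph.segment B.nw B.N a.snd b.snd with hP
  obtain ⟨c, hc⟩ : ∃ c, c ∈ C := by
    obtain ⟨e, he⟩ := Multiset.card_pos_iff_exists_mem.1 (show 0 < X₂.card by omega)
    obtain ⟨c, hc, -⟩ := hreach e he
    exact ⟨c, hc⟩
  have hcX : c ∈ X₂ := hX ▸ Multiset.mem_add.2 (Or.inl hc)
  -- The path between the outermost ends passes through all ends nested inside, among them that of a
  -- surviving link `c`.
  have hac : B.graph.Reach (↑P + J) a.snd c.snd :=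
    (B.N_path.1.reach_segment (hN a ha) (hN c (hmem c hcX)) (hle c (hmem c hcX))
      (hge c hcX)).mono (Multiset.subset_of_le (Multiset.le_add_right _ _))
  refine ⟨C, a ::ₘ b ::ₘ R, ↑P + J, by simp [hX], hC, ?_, ?_, ?_, ?_, ?_⟩
  · rw [Multiset.card_cons, Multiset.card_cons, add_assoc]
    exact hR.add (by norm_num)
  · intro d hdm
    rcases Multiset.mem_add.1 hdm with h | h
    · exact hinf.subset h
    · exact hJN d h
  · rw [WGraph.oddChain_add, hw.oddChain, hodd]
    simp [add_assoc]
  · intro e he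
    rcases Multiset.mem_cons.1 he with rfl | he
    · exact ⟨c, hc, hac⟩
    rcases Multiset.mem_cons.1 he with rfl | he
    · exact ⟨c, hc, (hw.reach.mono (Multiset.subset_of_le (Multiset.le_add_right _ _))).symm.trans
        hac⟩
    · obtain ⟨c', hc', h⟩ := hreach e he
      exact ⟨c', hc', h.mono (Multiset.subset_of_le (Multiset.le_add_left _ _))⟩
  · have h1 := B.N_short _ hinf _ _ hw
    have h2 : B.graph.length P ≤
        (1 + ε) * (B.graph.length a.edges + B.graph.length b.edges) := by
      have := h1.trans (mul_le_mul_right (hd a ha b hb') _)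
      rw [ENNReal.coe_zero, add_zero, one_mul] at this
      exact_mod_cast this
    rw [WGraph.length_add, Multiset.map_cons, Multiset.sum_cons, Multiset.map_cons,
      Multiset.sum_cons, ← add_assoc, mul_add]
    exact add_le_add h2 hlen

theorem ncard_joining_sum_le {X : Multiset (Link VB DB)} (hX : ∀ e ∈ X, B.IsLink e) :
    (B.graph.joiningVertices (X.map Link.edges).sum B.boundary).ncard ≤ 2 * X.card := by
  induction X using Multiset.induction with
  | empty => rw [joiningVertices_eq_empty B (by simp)]; simp
  | cons e X ih =>
    rw [Multiset.map_cons, Multiset.sum_cons, joiningVertices_add, Multiset.card_cons]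
    have h1 := (hX e (Multiset.mem_cons_self ..)).ncard_joining_le
    have h2 := ih fun f hf => hX f (Multiset.mem_cons_of_mem hf)
    have := Set.ncard_union_le (B.graph.joiningVertices e.edges B.boundary)
      (B.graph.joiningVertices (X.map Link.edges).sum B.boundary)
    omega

theorem oddChain_sum {X : Multiset (Link VB DB)} (hX : ∀ e ∈ X, B.IsLink e) :
    B.graph.oddChain (X.map Link.edges).sum = (X.map Link.ends).sum := by
  induction X using Multiset.induction with
  | empty => simp [WGraph.oddChain_zero]
  | cons e X ih =>
    rw [Multiset.map_cons, Multiset.sum_cons, WGraph.oddChain_add, Multiset.map_cons,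
      Multiset.sum_cons, (hX e (Multiset.mem_cons_self ..)).odd,
      ih fun f hf => hX f (Multiset.mem_cons_of_mem hf)]

theorem length_sum (X : Multiset (Link VB DB)) :
    B.graph.length (X.map Link.edges).sum = (X.map fun e => B.graph.length e.edges).sum := by
  induction X using Multiset.induction with
  | empty => simp [WGraph.length]
  | cons e X ih =>
    rw [Multiset.map_cons, Multiset.sum_cons, WGraph.length_add, Multiset.map_cons,
      Multiset.sum_cons, ih]

theorem edges_le_sum {X : Multiset (Link VB DB)} {e : Link VB DB} (he : e ∈ X) :
    e.edges ≤ (X.map Link.edges).sum := by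
  obtain ⟨Y, rfl⟩ := Multiset.exists_cons_of_mem he
  simp

end Replaceable

end Brick

/-! ### Links between `N` and `S` -/

namespace Brick

variable {V D VB DB : Type*} {G : WGraph V D} {ε : ℝ≥0} {κ : ℝ}

section Interval

variable {B : Brick G VB DB ε κ}

/-- Links from `N` to the part of `S` from `s i` to `s (i + 1)`. -/
theorem replaceable_interval {i : ℕ} (hi : i < B.k) {X : Multiset (Link VB DB)}
    (hX : ∀ e ∈ X, B.IsLink e) (hS : ∀ e ∈ X, e.fst ∈ B.graph.support B.sw B.S)
    (hN : ∀ e ∈ X, e.snd ∈ B.graph.support B.nw B.N)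
    (hl : ∀ e ∈ X, B.s i ≤ B.graph.pos B.sw B.S e.fst)
    (hr : ∀ e ∈ X, B.graph.pos B.sw B.S e.fst < B.s (i + 1)) : B.Replaceable 4 X := by
  classical
  rcases eq_or_ne X 0 with rfl | hX0
  · exact replaceable_zero.mono (by omega)
  set pos := B.graph.pos B.sw B.S with hpos
  obtain ⟨m, hm, hmax⟩ := X.toFinset.exists_max_image (fun e => pos e.fst)
    (by rwa [Finset.nonempty_iff_ne_empty, Ne, Multiset.toFinset_eq_empty])
  rw [Multiset.mem_toFinset] at hm
  replace hmax : ∀ e ∈ X, pos e.fst ≤ pos m.fst := fun e he => hmax e (Multiset.mem_toFinset.2 he)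
  -- A link reaches `N`, so its length bounds the distance to `N` in `s_close`. That condition
  -- concerns only vertices strictly after `s i`; at `s i` itself the segment is empty.
  have hclose : ∀ e ∈ X, B.graph.length ((B.S.take (pos e.fst)).drop (B.s i) : List DB) ≤
      ε * B.graph.length e.edges := by
    intro e he
    rcases (hl e he).eq_or_lt with h | h
    · rw [List.drop_eq_nil_of_le (by rw [List.length_take, h]; exact min_le_left _ _)]
      simp [WGraph.length]
    · have h1 := B.s_close i hi _ h (hr e he) _ (B.graph.getElem?_pos (hS e he))
      have h2 : B.graph.distTo e.fst {v | v ∈ B.graph.support B.nw B.N} ≤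
          B.graph.length e.edges :=
        (iInf₂_le e.snd (hN e he)).trans (hX e he).dist_le
      exact_mod_cast h1.le.trans (mul_le_mul_right h2 _)
  have hdistS : ∀ a ∈ X, ∀ b ∈ X, pos a.fst ≤ pos b.fst → B.graph.dist a.fst b.fst ≤
      (ε * B.graph.length b.edges : ℝ≥0) := by
    intro a ha b hb hab
    have hw := B.S_path.1.isWalk_segment (hS a ha) (hS b hb) hab
    refine hw.dist_le.trans (ENNReal.coe_le_coe.2 (le_trans ?_ (hclose b hb)))
    exact B.graph.length_list_mono (List.drop_sublist_drop_left _ (hl a ha))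
  have hdistS' : ∀ a ∈ X, ∀ b ∈ X, B.graph.dist a.fst b.fst ≤
      (ε * (B.graph.length a.edges + B.graph.length b.edges) : ℝ≥0) := by
    intro a ha b hb
    rcases le_total (pos a.fst) (pos b.fst) with h | h
    · exact (hdistS a ha b hb h).trans
        (ENNReal.coe_le_coe.2 (mul_le_mul_right le_add_self _))
    · rw [WGraph.dist_comm]
      exact (hdistS b hb a ha h).trans
        (ENNReal.coe_le_coe.2 (mul_le_mul_right le_self_add _))
  -- Two ends on `N` are joined by going through one link, along `S`, and back through the other,
  -- which gives the required factor `1 + ε`.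
  obtain ⟨C, R, J, hXC, hC, ⟨r, hR⟩, hJN, hJodd, hJreach, hJlen⟩ := exists_N_join X.card X rfl hN
    fun a ha b hb => by
      have h1 := (B.graph.dist_triangle a.snd a.fst b.snd).trans
        (add_le_add_right (B.graph.dist_triangle a.fst b.fst b.snd) _)
      refine h1.trans ((add_le_add ((B.graph.dist_comm _ _).trans_le (hX a ha).dist_le)
        (add_le_add (hdistS' a ha b hb) (hX b hb).dist_le)).trans ?_)
      rw [← ENNReal.coe_add, ← ENNReal.coe_add, ENNReal.coe_le_coe]
      exact le_of_eq (by ring)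
  have hCX : ∀ e ∈ C, e ∈ X := fun e he => hXC ▸ Multiset.mem_add.2 (Or.inl he)
  have hRX : ∀ e ∈ R, e ∈ X := fun e he => hXC ▸ Multiset.mem_add.2 (Or.inr he)
  -- the part of `S` from `s i` to the last end of a link
  have hsi : B.s i < (B.graph.support B.sw B.S).length := by
    have := B.s_mono hi.le
    rw [B.s_last] at this
    simp [WGraph.support]; omega
  set z := (B.graph.support B.sw B.S)[B.s i] with hz
  have hzget : (B.graph.support B.sw B.S)[B.s i]? = some z := List.getElem?_eq_getElem hsi
  have hzS : z ∈ B.graph.support B.sw B.S := List.getElem_mem hsi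
  have hzpos : pos z = B.s i := List.Nodup.idxOf_getElem B.S_path.2 _ hsi
  have hw := B.S_path.1.isWalk_segment hzS (hS m hm) (hzpos.trans_le (hl m hm))
  set P := B.graph.segment B.sw B.S z m.fst with hP
  have hPm : B.graph.length P ≤ ε * B.graph.length m.edges := by
    have := hclose m hm
    rw [← hzpos] at this
    exact this
  have hPr : ∀ e ∈ X, B.graph.Reach P z e.fst := fun e he =>
    B.S_path.1.reach_segment hzS (hS e he) (hzpos.trans_le (hl e he)) (hmax e he)
  have hPsup : ∀ e ∈ X, e.fst ∈ B.graph.support z P := by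
    intro e he
    have h1 := B.S_path.1.isWalk_segment hzS (hS e he) (hzpos.trans_le (hl e he))
    have h2 := B.S_path.1.isWalk_segment (hS e he) (hS m hm) (hmax e he)
    have h3 := hzpos.trans_le (hl e he)
    have h4 : P = B.graph.segment B.sw B.S z e.fst ++ B.graph.segment B.sw B.S e.fst m.fst := by
      rw [hP, WGraph.segment_eq, WGraph.segment_eq, WGraph.segment_eq]
      have h5 := hmax e he
      have h6 : (B.S.take (pos m.fst)) = B.S.take (pos e.fst) ++
          (B.S.take (pos m.fst)).drop (pos e.fst) := by
        conv_lhs => rw [← List.take_append_drop (pos e.fst) (B.S.take (pos m.fst))]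
        rw [List.take_take, min_eq_left h5]
      have h7 := B.graph.pos_le_length (hS e he)
      conv_lhs => rw [h6]
      rw [List.drop_append_of_le_length (by rw [List.length_take, min_eq_left h7]; exact h3)]
    rw [h4, h1.mem_support_append]
    exact Or.inr (WGraph.mem_support_start ..)
  -- Since `R` has even cardinality, the parity correction at the start `z` vanishes, and `K` has
  -- the parities of the ends on `S` of the deleted links.
  obtain ⟨K, hPK, hKP, hKodd⟩ := hw.exists_join (R.map Link.fst) fun x hx => by
    obtain ⟨e, he, rfl⟩ := Multiset.mem_map.1 hx
    exact hPsup e (hRX e he)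
  rw [Multiset.card_map, hR, ← two_mul, mul_nsmul, two_nsmul, WGraph.chain_add_self, smul_zero,
    add_zero, Multiset.map_map] at hKodd
  have hJ0 : B.graph.joiningVertices J B.boundary = ∅ :=
    joiningVertices_eq_empty B fun d hd => not_inner_N (hJN d hd)
  have hK0 : B.graph.joiningVertices K B.boundary = ∅ := by
    refine joiningVertices_eq_empty B fun d hd => not_inner_S ?_
    have h1 : d ∈ P := by
      have := Multiset.mem_of_le hKP hd
      simpa using this
    exact (B.graph.segment_infix _ _ _ _).subset h1
  refine ⟨(C.map Link.edges).sum + J + K, ?_, fun e he => ?_, ?_, ?_⟩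
  · rw [WGraph.oddChain_add, WGraph.oddChain_add, oddChain_sum fun e he => hX e (hCX e he), hJodd,
      hKodd, hXC, Multiset.map_add, Multiset.sum_add, add_assoc, ← Multiset.sum_map_add]
    congr 2
    exact Multiset.map_congr rfl fun e _ => add_comm _ _
  · obtain ⟨c, hc, hec⟩ := hJreach e he
    have hK' : (P : Multiset DB) ⊆ (C.map Link.edges).sum + J + K :=
      Multiset.subset_of_le (hPK.trans (Multiset.le_add_left _ _))
    have h1 := ((hPr e he).mono hK').symm.trans ((hPr c (hCX c hc)).mono hK')
    have h2 := (hX c (hCX c hc)).reach.mono (Multiset.subset_of_le ((edges_le_sum hc).trans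
      ((Multiset.le_add_right _ J).trans (Multiset.le_add_right _ K))))
    have h3 := hec.mono (Multiset.subset_of_le ((Multiset.le_add_left J (C.map Link.edges).sum).trans
      (Multiset.le_add_right _ K)))
    exact h1.trans (h2.trans h3.symm)
  · have hKlen : B.graph.length K ≤ 2 * (ε * (X.map fun e => B.graph.length e.edges).sum) := by
      refine (B.graph.length_mono hKP).trans ?_
      rw [WGraph.length_add, ← two_mul]
      refine mul_le_mul_right (hPm.trans (mul_le_mul_right ?_ _)) _
      exact Multiset.single_le_sum (fun _ _ => zero_le) _
        (Multiset.mem_map_of_mem (fun e : Link VB DB => B.graph.length e.edges) hm)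
    -- The doubled path is charged to `m`, which may lie in `C` or in `R`, hence to the whole sum.
    -- Kept links then cost a factor `1 + 2ε`, deleted ones `1 + 3ε`.
    rw [WGraph.length_add, WGraph.length_add, length_sum]
    rw [hXC, Multiset.map_add, Multiset.sum_add] at hKlen ⊢
    generalize (C.map fun e => B.graph.length e.edges).sum = c at *
    generalize (R.map fun e => B.graph.length e.edges).sum = r at *
    calc c + B.graph.length J + B.graph.length K ≤ c + (1 + ε) * r + 2 * (ε * (c + r)) := by
          gcongr
      _ ≤ c + (1 + ε) * r + 2 * (ε * (c + r)) + ε * c := le_self_add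
      _ = (1 + 3 * ε) * (c + r) := by ring
  · rw [joiningVertices_add, joiningVertices_add, hJ0, hK0, Set.union_empty, Set.union_empty]
    have := ncard_joining_sum_le (B := B) (X := C) fun e he => hX e (hCX e he)
    omega

/-- Links from `S` to `N`. -/
theorem replaceable_NS {X : Multiset (Link VB DB)}
    (hX : ∀ e ∈ X, B.IsLink e) (hS : ∀ e ∈ X, e.fst ∈ B.graph.support B.sw B.S)
    (hN : ∀ e ∈ X, e.snd ∈ B.graph.support B.nw B.N)
    (hE : ∀ e ∈ X, e.fst ∉ B.graph.support B.ne B.E) : B.Replaceable (4 * B.k) X := by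
  -- Induction over half-open intervals of positions. They cover every end on `S`, because an end
  -- off `E` lies strictly before the last position.
  suffices h : ∀ j ≤ B.k, ∀ X : Multiset (Link VB DB),
      (∀ e ∈ X, B.IsLink e) → (∀ e ∈ X, e.fst ∈ B.graph.support B.sw B.S) →
      (∀ e ∈ X, e.snd ∈ B.graph.support B.nw B.N) →
      (∀ e ∈ X, B.graph.pos B.sw B.S e.fst < B.s j) → B.Replaceable (4 * j) X from
    h B.k le_rfl X hX hS hN fun e he => by
      rw [B.s_last]
      exact pos_S_lt (hS e he) (hE e he)
  intro j
  induction j with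
  | zero =>
    intro _ X _ _ _ h
    have : X = 0 := Multiset.eq_zero_of_forall_notMem fun e he => by
      have := h e he
      rw [B.s_zero] at this
      omega
    subst this
    exact replaceable_zero
  | succ j ih =>
    intro hj X hX hS hN h
    rw [← Multiset.filter_add_not (fun e => B.graph.pos B.sw B.S e.fst < B.s j) X]
    refine (ih (by omega) _ ?_ ?_ ?_ ?_).add (replaceable_interval (i := j) (by omega) ?_ ?_ ?_ ?_ ?_)
    all_goals
      intro e he
      obtain ⟨he, he'⟩ := Multiset.mem_filter.1 he
    exacts [hX e he, hS e he, hN e he, he', hX e he, hS e he, hN e he, not_lt.1 he', h e he]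

end Interval

end Brick

/-! ### Crossings, and the darts that enter or leave a side -/

theorem List.countP_eq_ncard {α : Type*} (q : α → Prop) [DecidablePred q] (T : List α) :
    T.countP (fun a => decide (q a)) = Set.ncard {i : ℕ | ∃ a, T[i]? = some a ∧ q a} := by
  induction T using List.reverseRecOn with
  | nil => simp
  | append_singleton T a ih =>
    have hfin : Set.Finite {i : ℕ | ∃ a, T[i]? = some a ∧ q a} :=
      (Set.finite_lt_nat T.length).subset fun i ⟨b, hb, _⟩ => (List.getElem?_eq_some_iff.1 hb).1
    have hnot : T.length ∉ {i : ℕ | ∃ a, T[i]? = some a ∧ q a} := by simp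
    rw [List.countP_append, ih, List.countP_singleton]
    have hget : ∀ i b, (T ++ [a])[i]? = some b ↔ T[i]? = some b ∨ i = T.length ∧ a = b := by
      intro i b
      rcases lt_trichotomy i T.length with h | h | h
      · rw [List.getElem?_append_left h]
        simp [h.ne]
      · subst h; simp
      · rw [List.getElem?_eq_none (by simp; omega), List.getElem?_eq_none h.le]
        simp [h.ne']
    by_cases ha : q a
    · have : {i : ℕ | ∃ b, (T ++ [a])[i]? = some b ∧ q b} =
          insert T.length {i : ℕ | ∃ a, T[i]? = some a ∧ q a} := by
        ext i
        simp only [hget, Set.mem_ofPred_eq, Set.mem_insert_iff]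
        constructor
        · rintro ⟨b, h | ⟨h, rfl⟩, hb⟩
          · exact Or.inr ⟨b, h, hb⟩
          · exact Or.inl h
        · rintro (h | ⟨b, h, hb⟩)
          · exact ⟨a, Or.inr ⟨h, rfl⟩, ha⟩
          · exact ⟨b, Or.inl h, hb⟩
      rw [this, Set.ncard_insert_of_notMem hnot hfin]
      simp [ha]
    · have : {i : ℕ | ∃ b, (T ++ [a])[i]? = some b ∧ q b} =
          {i : ℕ | ∃ a, T[i]? = some a ∧ q a} := by
        ext i
        simp only [hget, Set.mem_ofPred_eq]
        constructor
        · rintro ⟨b, h | ⟨h, rfl⟩, hb⟩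
          · exact ⟨b, h, hb⟩
          · exact absurd hb ha
        · rintro ⟨b, h, hb⟩
          exact ⟨b, Or.inl h, hb⟩
      rw [this]
      simp [ha]

namespace Brick

variable {V D VB DB : Type*} {G : WGraph V D} {ε : ℝ≥0} {κ : ℝ}

theorem Inner.rev {B : Brick G VB DB ε κ} {d : DB} (h : B.Inner d) : B.Inner (B.graph.rev d) := by
  intro h'
  rw [WGraph.OnWalk, B.graph.rev_rev] at h'
  exact h h'.symm

/-- A dart strictly inside has only one copy, so its image in `G` cannot also be an edge of a side.
Such a dart therefore delimits the runs along the side that `crossings` counts. -/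
theorem Inner.not_onWalk {B : Brick G VB DB ε κ} {d : DB} (h : B.Inner d) {P : List DB}
    (hP : ∀ c ∈ P, c ∈ B.boundary) : ¬ G.OnWalk (P.map B.dmap) (B.dmap d) := by
  rintro (h' | h')
  · obtain ⟨c, hc, hcd⟩ := List.mem_map.1 h'
    rw [B.dmap_inner d h c hcd] at hc
    exact h (Or.inl (hP d hc))
  · obtain ⟨c, hc, hcd⟩ := List.mem_map.1 h'
    rw [← B.dmap_rev] at hcd
    rw [B.dmap_inner _ h.rev c hcd] at hc
    exact h (Or.inr (hP _ hc))

/-- The dart `a` leads from the side `P` of the brick to its inside. -/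
def LeavesSide (B : Brick G VB DB ε κ) (p : VB) (P : List DB) (a : D) : Prop :=
  ∃ d, B.Inner d ∧ B.dmap d = a ∧ B.graph.tail d ∈ B.graph.support p P

/-- The dart `a` leads from the inside of the brick to its side `P`. -/
def EntersSide (B : Brick G VB DB ε κ) (p : VB) (P : List DB) (a : D) : Prop :=
  ∃ d, B.Inner d ∧ B.dmap d = a ∧ B.graph.head d ∈ B.graph.support p P

-- A crossing is indexed by the dart just before it, so every entering dart is itself the index of a
-- crossing.
open Classical in
theorem countP_entersSide_le_crossings (B : Brick G VB DB ε κ) (T : List D) (p : VB) (P : List DB)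
    (hP : ∀ c ∈ P, c ∈ B.boundary) :
    T.countP (fun a => decide (B.EntersSide p P a)) ≤ B.crossings T p P := by
  rw [List.countP_eq_ncard, crossings]
  refine Set.ncard_le_ncard ?_ ((Set.finite_lt_nat T.length).subset fun i hi => hi.1)
  rintro i ⟨a, hia, d, hd, rfl, hdP⟩
  have hi : i < T.length := (List.getElem?_eq_some_iff.1 hia).1
  have hn := hd.not_onWalk hP
  -- After a full turn of the cyclic walk the entering dart itself recurs, so some later dart is off
  -- `P`.
  have hex : ∃ j, 1 ≤ j ∧ ∃ b, T[(i + j) % T.length]? = some b ∧ ¬ G.OnWalk (P.map B.dmap) b :=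
    ⟨T.length, by omega, _, by rw [Nat.add_mod_right, Nat.mod_eq_of_lt hi]; exact hia, hn⟩
  obtain ⟨h1, b, hb, hb'⟩ := Nat.find_spec hex
  refine ⟨hi, Nat.find hex - 1, B.dmap d, b, hia, hn, fun j hj hj' => ?_, ?_, hb',
    Or.inl ⟨d, hd, rfl, hdP⟩⟩
  · have hlt : (i + j) % T.length < T.length := Nat.mod_lt _ (by omega)
    have := Nat.find_min hex (m := j) (by omega)
    push Not at this
    exact ⟨_, List.getElem?_eq_getElem hlt, this hj _ (List.getElem?_eq_getElem hlt)⟩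
  · rw [add_assoc, Nat.sub_add_cancel h1]
    exact hb

-- A leaving dart comes just after its crossing. The map `next` sends the index of a crossing to the
-- first later dart off `P`, and every leaving dart is in its image, so there are no more leaving
-- darts than crossings.
open Classical in
theorem countP_leavesSide_le_crossings (B : Brick G VB DB ε κ) (T : List D) (p : VB) (P : List DB)
    (hP : ∀ c ∈ P, c ∈ B.boundary) :
    T.countP (fun a => decide (B.LeavesSide p P a)) ≤ B.crossings T p P := by
  rw [List.countP_eq_ncard, crossings]
  set C : Set ℕ := {i : ℕ | i < T.length ∧ ∃ (m : ℕ) (a b : D),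
    T[i]? = some a ∧ ¬ G.OnWalk (P.map B.dmap) a ∧
    (∀ j, 1 ≤ j → j ≤ m → ∃ c, T[(i + j) % T.length]? = some c ∧ G.OnWalk (P.map B.dmap) c) ∧
    T[(i + m + 1) % T.length]? = some b ∧ ¬ G.OnWalk (P.map B.dmap) b ∧
    ((∃ d, B.Inner d ∧ B.dmap d = a ∧ B.graph.head d ∈ B.graph.support p P) ∨
      (∃ d, B.Inner d ∧ B.dmap d = b ∧ B.graph.tail d ∈ B.graph.support p P))} with hC
  have hfin : C.Finite := (Set.finite_lt_nat T.length).subset fun i hi => hi.1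
  let off : ℕ → ℕ → Prop := fun i t =>
    1 ≤ t ∧ ∃ b, T[(i + t) % T.length]? = some b ∧ ¬ G.OnWalk (P.map B.dmap) b
  let next : ℕ → ℕ := fun i => (i + sInf {t | off i t}) % T.length
  refine (Set.ncard_le_ncard (t := next '' C) ?_ (hfin.image _)).trans (Set.ncard_image_le hfin)
  rintro j ⟨b, hjb, d, hd, rfl, hdP⟩
  have hj : j < T.length := (List.getElem?_eq_some_iff.1 hjb).1
  have hn := hd.not_onWalk hP
  -- `t` is the number of steps back from `j` to the last dart off `P`
  have hex : ∃ t, 1 ≤ t ∧ ∃ a, T[(j + (T.length - t)) % T.length]? = some a ∧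
      ¬ G.OnWalk (P.map B.dmap) a :=
    ⟨T.length, by omega, _, by rw [Nat.sub_self, add_zero, Nat.mod_eq_of_lt hj]; exact hjb, hn⟩
  obtain ⟨ht1, a, ha, ha'⟩ := Nat.find_spec hex
  have htn : Nat.find hex ≤ T.length :=
    Nat.find_min' hex ⟨by omega, _, by
      rw [Nat.sub_self, add_zero, Nat.mod_eq_of_lt hj]; exact hjb, hn⟩
  have hmin : ∀ l, 1 ≤ l → l < Nat.find hex → ∃ c,
      T[(j + (T.length - l)) % T.length]? = some c ∧ G.OnWalk (P.map B.dmap) c := by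
    intro l hl hl'
    have hlt : (j + (T.length - l)) % T.length < T.length := Nat.mod_lt _ (by omega)
    have := Nat.find_min hex hl'
    push Not at this
    exact ⟨_, List.getElem?_eq_getElem hlt, this hl _ (List.getElem?_eq_getElem hlt)⟩
  generalize Nat.find hex = t at *
  set i := (j + (T.length - t)) % T.length with hi
  have hon : ∀ l, 1 ≤ l → l < t → ∃ c,
      T[(i + l) % T.length]? = some c ∧ G.OnWalk (P.map B.dmap) c := by
    intro l hl hl'
    have : (i + l) % T.length = (j + (T.length - (t - l))) % T.length := by
      rw [hi, Nat.mod_add_mod]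
      congr 1
      omega
    rw [this]
    exact hmin (t - l) (by omega) (by omega)
  have hit : (i + t) % T.length = j := by
    rw [hi, Nat.mod_add_mod, show j + (T.length - t) + t = j + T.length by omega,
      Nat.add_mod_right, Nat.mod_eq_of_lt hj]
  refine ⟨i, ⟨Nat.mod_lt _ (by omega), t - 1, a, B.dmap d, ha, ha',
    fun l hl hl' => hon l hl (by omega), ?_, hn, Or.inr ⟨d, hd, rfl, hdP⟩⟩, ?_⟩
  · rw [add_assoc, Nat.sub_add_cancel ht1, hit]
    exact hjb
  · have hoff : off i t := ⟨ht1, B.dmap d, by rw [hit]; exact hjb, hn⟩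
    have hinf : sInf {t | off i t} = t := by
      refine le_antisymm (Nat.sInf_le hoff) ?_
      by_contra! hlt
      obtain ⟨h1, c, hc, hc'⟩ : off i (sInf {t | off i t}) := Nat.sInf_mem (s := {t | off i t}) ⟨t, hoff⟩
      obtain ⟨c', hcc, hc''⟩ := hon _ h1 hlt
      rw [hc] at hcc
      cases hcc
      exact hc' hc''
    change (i + sInf {t | off i t}) % T.length = j
    rw [hinf, hit]

/-! ### Decomposing the tour into excursions -/

theorem head_mem_boundaryVertices {B : Brick G VB DB ε κ} {d : DB} (h : d ∈ B.boundary) :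
    B.graph.head d ∈ B.boundaryVertices := by
  -- The boundary is a facial walk, so the face permutation keeps `d` on it, and the image of `d`
  -- starts at the head of `d`.
  have h1 : B.graph.facePerm B.rot d ∈ B.boundary := by
    have h2 : B.graph.facePerm B.rot d ∈ B.boundary.map (B.graph.facePerm B.rot) :=
      List.mem_map_of_mem h
    rw [show B.boundary.map _ = B.boundary.rotate 1 from B.boundary_facial.2.2] at h2
    exact List.mem_rotate.1 h2
  refine ⟨_, h1, ?_⟩
  exact ((B.planar.1 _ _).1 (show B.rot.SameCycle (B.graph.rev d) (B.rot (B.graph.rev d)) from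
    ⟨1, by simp⟩)).symm

theorem tail_mem_boundaryVertices {B : Brick G VB DB ε κ} {d : DB} (h : ¬ B.Inner d) :
    B.graph.tail d ∈ B.boundaryVertices := by
  rcases not_not.1 h with h | h
  · exact ⟨d, h, rfl⟩
  · rw [← B.graph.head_rev]
    exact head_mem_boundaryVertices h

theorem mem_sides_of_mem_boundaryVertices {B : Brick G VB DB ε κ} {v : VB}
    (h : v ∈ B.boundaryVertices) :
    v ∈ B.graph.support B.sw B.W ∨ v ∈ B.graph.support B.nw B.N ∨
      v ∈ B.graph.support B.ne B.E ∨ v ∈ B.graph.support B.sw B.S := by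
  obtain ⟨d, hd, rfl⟩ := h
  rcases mem_boundary.1 hd with h | h | h | h
  · exact Or.inl (B.W_path.1.tail_mem h)
  · exact Or.inr (Or.inl (B.N_path.1.tail_mem h))
  · exact Or.inr (Or.inr (Or.inl (B.E_path.1.tail_mem h)))
  · refine Or.inr (Or.inr (Or.inr ?_))
    rw [← B.graph.head_rev]
    exact B.graph.head_mem_support _ h

/-- The vertex `v` of `G` is not strictly inside the brick. -/
def Outer (B : Brick G VB DB ε κ) (v : V) : Prop :=
  ∀ w, B.vmap w = v → w ∈ B.boundaryVertices

/-- A vertex strictly inside has no second copy, so a vertex of `G` with one copy on the boundary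
has all its copies there. -/
theorem outer_of_mem {B : Brick G VB DB ε κ} {b : VB} (hb : b ∈ B.boundaryVertices) :
    B.Outer (B.vmap b) := by
  intro w hw
  by_contra hw'
  have h := B.vmap_inner w (fun d hd hdw => hw' ⟨d, hd, hdw⟩) b hw.symm
  exact hw' (h ▸ hb)

theorem vmap_head (B : Brick G VB DB ε κ) (d : DB) :
    B.vmap (B.graph.head d) = G.head (B.dmap d) := by
  rw [WGraph.head, B.vmap_tail, B.dmap_rev, WGraph.head]

/-- A link given by a maximal subwalk of a tour strictly inside the brick. -/
structure IsExcursion (B : Brick G VB DB ε κ) (e : Link VB DB) : Prop where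
  isLink : B.IsLink e
  inner : ∀ d ∈ e.edges, B.Inner d
  leaves : ∃ d ∈ e.edges, B.graph.tail d = e.fst
  enters : ∃ d ∈ e.edges, B.graph.head d = e.snd
  fst_mem : e.fst ∈ B.boundaryVertices
  snd_mem : e.snd ∈ B.boundaryVertices

/-- The part of a walk of `G` from a vertex strictly inside the brick to the boundary. -/
theorem exists_exit (B : Brick G VB DB ε κ) {L : List D} {u v : V} (hL : G.IsWalk u L v)
    (hv : B.Outer v) {w : VB} (hw : w ∉ B.boundaryVertices) (hwu : B.vmap w = u) :
    ∃ (P : List DB) (y : VB) (L₂ : List D), L = P.map B.dmap ++ L₂ ∧ B.graph.IsWalk w P y ∧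
      y ∈ B.boundaryVertices ∧ G.IsWalk (B.vmap y) L₂ v ∧
      (∀ d ∈ P, B.Inner d ∧ B.graph.tail d ∉ B.boundaryVertices ∧
        (B.graph.head d ∈ B.boundaryVertices → B.graph.head d = y)) ∧
      (∃ d ∈ P, B.graph.head d = y) ∧
      ∀ z ∈ G.support u L, B.Outer z → z ∈ G.support (B.vmap y) L₂ := by
  induction L generalizing u w with
  | nil =>
    cases hL
    exact absurd (hv w hwu) hw
  | cons a L ih =>
    -- At a vertex strictly inside, the brick contains the whole star of `G`, so the next dart of
    -- the walk lifts.
    obtain ⟨e, he, rfl⟩ := B.star_inner w (fun d hd hdw => hw ⟨d, hd, hdw⟩) a (hL.1.trans hwu.symm)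
    have hinner : B.Inner e := by
      by_contra h
      exact hw (he ▸ tail_mem_boundaryVertices h)
    have hu : ¬ B.Outer u := fun h => hw (h w hwu)
    have hL2 := hL.2
    rw [← B.vmap_head] at hL2
    by_cases hy : B.graph.head e ∈ B.boundaryVertices
    · refine ⟨[e], _, L, rfl, ⟨he, rfl⟩, hy, hL2, ?_, ⟨e, by simp, rfl⟩, ?_⟩
      · intro d hd
        rw [List.mem_singleton] at hd
        subst hd
        exact ⟨hinner, he ▸ hw, fun _ => rfl⟩
      · intro z hz hzo
        rw [WGraph.support_cons, List.mem_cons, ← B.vmap_head] at hz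
        exact hz.resolve_left fun h => hu (h ▸ hzo)
    · obtain ⟨P, y, L₂, rfl, h1, h2, h3, h4, ⟨f, hf, hfy⟩, h6⟩ := ih hL2 hy rfl
      refine ⟨e :: P, y, L₂, rfl, ⟨he, h1⟩, h2, h3, ?_, ⟨f, List.mem_cons_of_mem _ hf, hfy⟩, ?_⟩
      · intro d hd
        rcases List.mem_cons.1 hd with rfl | hd
        · exact ⟨hinner, he ▸ hw, fun h => absurd h hy⟩
        · exact h4 d hd
      · intro z hz hzo
        rw [WGraph.support_cons, List.mem_cons, ← B.vmap_head] at hz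
        exact h6 z (hz.resolve_left fun h => hu (h ▸ hzo)) hzo

/-- Between its ends the walk avoids the boundary, so only the ends can be joining vertices. The
hypothesis `hey` allows for a single edge that goes straight back to the boundary. -/
theorem isExcursion_of_walk {B : Brick G VB DB ε κ} {e : DB} {P : List DB} {y : VB}
    (he : B.Inner e) (hx : B.graph.tail e ∈ B.boundaryVertices) (hy : y ∈ B.boundaryVertices)
    (hP : B.graph.IsWalk (B.graph.head e) P y)
    (hin : ∀ d ∈ P, B.Inner d ∧ B.graph.tail d ∉ B.boundaryVertices ∧
        (B.graph.head d ∈ B.boundaryVertices → B.graph.head d = y))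
    (hey : B.graph.head e ∈ B.boundaryVertices → B.graph.head e = y)
    (hex : ∃ d ∈ e :: P, B.graph.head d = y) :
    B.IsExcursion ⟨B.graph.tail e, (e :: P : List DB), y⟩ := by
  have hw : B.graph.IsWalk (B.graph.tail e) (e :: P) y := ⟨rfl, hP⟩
  refine ⟨⟨hw.oddChain, hw.reach, hw.dist_le, ?_⟩, ?_, ⟨e, by simp, rfl⟩, by simpa using hex, hx, hy⟩
  · rintro v ⟨⟨c, hc, hcv⟩, d, hd, -, hdv⟩
    have hv : v ∈ B.boundaryVertices := by
      rcases hcv with rfl | rfl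
      · exact ⟨c, hc, rfl⟩
      · exact head_mem_boundaryVertices hc
    rw [Multiset.mem_coe, List.mem_cons] at hd
    rcases hd with rfl | hd
    · rcases hdv with rfl | rfl
      · simp
      · simp [hey hv]
    · obtain ⟨-, h1, h2⟩ := hin d hd
      rcases hdv with rfl | rfl
      · exact absurd hv h1
      · simp [h2 hv]
  · intro d hd
    rw [Multiset.mem_coe, List.mem_cons] at hd
    rcases hd with rfl | hd
    · exact he
    · exact (hin d hd).1

/-- A walk of `G` whose ends are not strictly inside the brick consists of edges that are not
strictly inside the brick and of excursions into it. -/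
theorem exists_decomposition (B : Brick G VB DB ε κ) (n : ℕ) (L : List D) (hn : L.length = n)
    {u v : V} (hL : G.IsWalk u L v) (hu : B.Outer u) (hv : B.Outer v) :
    ∃ (K : Multiset D) (X : Multiset (Link VB DB)), (∀ e ∈ X, B.IsExcursion e) ∧
      (∀ d ∈ K, d ∉ B.innerEdges) ∧
      (L : Multiset D) = K + (X.map Link.edges).sum.map B.dmap ∧
      ∀ r : V → V → Prop, Equivalence r → (∀ d ∈ K, r (G.tail d) (G.head d)) →
        (∀ e ∈ X, r (B.vmap e.fst) (B.vmap e.snd)) →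
        ∀ z ∈ G.support u L, B.Outer z → r u z := by
  induction n using Nat.strong_induction_on generalizing L u with
  | _ n ih =>
  cases L with
  | nil =>
    refine ⟨0, 0, by simp, by simp, by simp, fun r hr _ _ z hz _ => ?_⟩
    have : z = u := by simpa [WGraph.support] using hz
    exact this ▸ hr.refl _
  | cons a L =>
    rw [List.length_cons] at hn
    by_cases ha : a ∈ B.innerEdges
    · obtain ⟨e, he, rfl⟩ := ha
      have hx : B.graph.tail e ∈ B.boundaryVertices := hu _ ((B.vmap_tail e).trans hL.1)
      have hxu : B.vmap (B.graph.tail e) = u := (B.vmap_tail e).trans hL.1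
      have hL2 := hL.2
      rw [← B.vmap_head] at hL2
      obtain ⟨P, y, L₂, rfl, hX, hL₂, hsup⟩ : ∃ (P : List DB) (y : VB) (L₂ : List D),
          L = P.map B.dmap ++ L₂ ∧ B.IsExcursion ⟨B.graph.tail e, (e :: P : List DB), y⟩ ∧
          G.IsWalk (B.vmap y) L₂ v ∧
          ∀ z ∈ G.support (B.vmap (B.graph.head e)) L, B.Outer z →
            z ∈ G.support (B.vmap y) L₂ := by
        by_cases hy : B.graph.head e ∈ B.boundaryVertices
        · exact ⟨[], B.graph.head e, L, rfl,
            isExcursion_of_walk he hx hy rfl (by simp) (fun _ => rfl) ⟨e, by simp, rfl⟩, hL2,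
            fun z hz _ => hz⟩
        · obtain ⟨P, y, L₂, rfl, h1, h2, h3, h4, ⟨f, hf, hfy⟩, h6⟩ := B.exists_exit hL2 hv hy rfl
          exact ⟨P, y, L₂, rfl, isExcursion_of_walk he hx h2 h1 h4 (fun h => absurd h hy)
            ⟨f, List.mem_cons_of_mem _ hf, hfy⟩, h3, h6⟩
      obtain ⟨K, X, hXe, hK, hdec, hr⟩ := ih L₂.length
        (by rw [List.length_append] at hn; omega) L₂ rfl hL₂ (outer_of_mem hX.snd_mem)
      refine ⟨K, ⟨B.graph.tail e, (e :: P : List DB), y⟩ ::ₘ X, ?_, hK, ?_, ?_⟩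
      · intro f hf
        rcases Multiset.mem_cons.1 hf with rfl | hf
        · exact hX
        · exact hXe f hf
      · rw [Multiset.map_cons, Multiset.sum_cons, Multiset.map_add, add_left_comm, ← hdec,
          Multiset.map_coe, Multiset.coe_add, List.map_cons, List.cons_append]
      · intro r hre hrK hrX z hz hzo
        rw [WGraph.support_cons, List.mem_cons] at hz
        rcases hz with rfl | hz
        · exact hre.refl _
        · have h1 := hrX _ (Multiset.mem_cons_self ..)
          simp only [hxu] at h1
          rw [← B.vmap_head] at hz
          exact hre.trans h1 (hr r hre hrK (fun f hf => hrX f (Multiset.mem_cons_of_mem hf)) z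
            (hsup z hz hzo) hzo)
    -- All edges at a vertex strictly inside are strictly inside, so a dart that is not cannot end
    -- at such a vertex.
    · have ho : B.Outer (G.head a) := by
        intro w hw
        by_contra hwb
        obtain ⟨d, hd, hda⟩ := B.star_inner w (fun d hd hdw => hwb ⟨d, hd, hdw⟩) (G.rev a) hw.symm
        refine ha ⟨B.graph.rev d, Inner.rev ?_, by rw [B.dmap_rev, hda, G.rev_rev]⟩
        by_contra h
        exact hwb (hd ▸ tail_mem_boundaryVertices h)
      obtain ⟨K, X, hXe, hK, hdec, hr⟩ := ih L.length (by omega) L rfl hL.2 ho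
      refine ⟨a ::ₘ K, X, hXe, ?_, ?_, ?_⟩
      · intro d hd
        rcases Multiset.mem_cons.1 hd with rfl | hd
        · exact ha
        · exact hK d hd
      · rw [Multiset.cons_add, ← hdec, Multiset.cons_coe]
      · intro r hre hrK hrX z hz hzo
        rw [WGraph.support_cons, List.mem_cons] at hz
        rcases hz with rfl | hz
        · exact hre.refl _
        · have h1 := hrK a (Multiset.mem_cons_self ..)
          rw [hL.1] at h1
          exact hre.trans h1 (hr r hre (fun f hf => hrK f (Multiset.mem_cons_of_mem hf)) hrX z
            hz hzo)

end Brick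

/-! ### Sorting the excursions and assembling the new tour -/

namespace WGraph

variable {V D : Type*}

theorem IsWalk.exists_rotation {G : WGraph V D} {u w : V} {L : List D} (h : G.IsWalk u L u)
    (hw : w ∈ G.support u L) : ∃ L', G.IsWalk w L' w ∧ (L' : Multiset D) = L ∧
      ∀ z, z ∈ G.support u L → z ∈ G.support w L' := by
  obtain ⟨L₁, L₂, rfl, h1, h2⟩ := h.exists_split hw
  refine ⟨L₂ ++ L₁, h2.append h1, ?_, fun z => ?_⟩
  · rw [← Multiset.coe_add, ← Multiset.coe_add, add_comm]
  · rw [h1.mem_support_append, h2.mem_support_append]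
    exact Or.symm

end WGraph

namespace Brick

variable {V D VB DB : Type*} {G : WGraph V D} {ε : ℝ≥0} {κ : ℝ}

section

variable {B : Brick G VB DB ε κ}

-- Each counted excursion contributes its own dart leaving the side, since the edge multisets of the
-- excursions are added up with multiplicity.
open Classical in
theorem card_filter_fst_le {X : Multiset (Link VB DB)} (hX : ∀ e ∈ X, B.IsExcursion e) (p : VB)
    (P : List DB) : (X.filter fun e => e.fst ∈ B.graph.support p P).card ≤
      ((X.map Link.edges).sum.map B.dmap).countP (B.LeavesSide p P) := by
  induction X using Multiset.induction with
  | empty => simp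
  | cons e X ih =>
    have h1 := ih fun f hf => hX f (Multiset.mem_cons_of_mem hf)
    have he := hX e (Multiset.mem_cons_self ..)
    rw [Multiset.map_cons, Multiset.sum_cons, Multiset.map_add, Multiset.countP_add]
    by_cases h : e.fst ∈ B.graph.support p P
    · rw [Multiset.filter_cons_of_pos (p := fun e : Link VB DB => e.fst ∈ B.graph.support p P) X h, Multiset.card_cons]
      obtain ⟨d, hd, hde⟩ := he.leaves
      have : 0 < (e.edges.map B.dmap).countP (B.LeavesSide p P) :=
        Multiset.countP_pos.2 ⟨_, Multiset.mem_map_of_mem _ hd, d, he.inner d hd, rfl, hde ▸ h⟩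
      omega
    · rw [Multiset.filter_cons_of_neg (p := fun e : Link VB DB => e.fst ∈ B.graph.support p P) X h]
      omega

open Classical in
theorem card_filter_snd_le {X : Multiset (Link VB DB)} (hX : ∀ e ∈ X, B.IsExcursion e) (p : VB)
    (P : List DB) : (X.filter fun e => e.snd ∈ B.graph.support p P).card ≤
      ((X.map Link.edges).sum.map B.dmap).countP (B.EntersSide p P) := by
  induction X using Multiset.induction with
  | empty => simp
  | cons e X ih =>
    have h1 := ih fun f hf => hX f (Multiset.mem_cons_of_mem hf)
    have he := hX e (Multiset.mem_cons_self ..)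
    rw [Multiset.map_cons, Multiset.sum_cons, Multiset.map_add, Multiset.countP_add]
    by_cases h : e.snd ∈ B.graph.support p P
    · rw [Multiset.filter_cons_of_pos (p := fun e : Link VB DB => e.snd ∈ B.graph.support p P) X h, Multiset.card_cons]
      obtain ⟨d, hd, hde⟩ := he.enters
      have : 0 < (e.edges.map B.dmap).countP (B.EntersSide p P) :=
        Multiset.countP_pos.2 ⟨_, Multiset.mem_map_of_mem _ hd, d, he.inner d hd, rfl, hde ▸ h⟩
      omega
    · rw [Multiset.filter_cons_of_neg (p := fun e : Link VB DB => e.snd ∈ B.graph.support p P) X h]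
      omega

open Classical in
/-- The number of excursions that start or end on a side that the tour crosses at most twice. -/
theorem card_filter_side_le {T : List D} {K : Multiset D} {X : Multiset (Link VB DB)}
    (hX : ∀ e ∈ X, B.IsExcursion e)
    (hT : (T : Multiset D) = K + (X.map Link.edges).sum.map B.dmap) {p : VB} {P : List DB}
    (hP : ∀ c ∈ P, c ∈ B.boundary) (hc : B.crossings T p P ≤ 2) :
    (X.filter fun e => e.fst ∈ B.graph.support p P ∨ e.snd ∈ B.graph.support p P).card ≤ 4 := by
  have h1 := (card_filter_fst_le hX p P).trans ((Multiset.countP_le_of_le _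
    (Multiset.le_add_left _ K)).trans ((congrArg _ hT).symm.trans
      (Multiset.coe_countP _ _)).le |>.trans (B.countP_leavesSide_le_crossings T p P hP))
  have h2 := (card_filter_snd_le hX p P).trans ((Multiset.countP_le_of_le _
    (Multiset.le_add_left _ K)).trans ((congrArg _ hT).symm.trans
      (Multiset.coe_countP _ _)).le |>.trans (B.countP_entersSide_le_crossings T p P hP))
  have h3 := congrArg Multiset.card (Multiset.filter_add_filter
    (fun e : Link VB DB => e.fst ∈ B.graph.support p P) (fun e => e.snd ∈ B.graph.support p P) X)
  rw [Multiset.card_add, Multiset.card_add] at h3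
  omega

/-- Links between `N` and `S`, in either direction. -/
theorem replaceable_NS_of_or {X : Multiset (Link VB DB)} (hX : ∀ e ∈ X, B.IsLink e)
    (h : ∀ e ∈ X,
      (e.fst ∈ B.graph.support B.sw B.S ∧ e.snd ∈ B.graph.support B.nw B.N ∧
        e.fst ∉ B.graph.support B.ne B.E) ∨
      (e.snd ∈ B.graph.support B.sw B.S ∧ e.fst ∈ B.graph.support B.nw B.N ∧
        e.snd ∉ B.graph.support B.ne B.E)) : B.Replaceable (4 * B.k) X := by
  classical
  set q : Link VB DB → Prop := fun e => e.fst ∈ B.graph.support B.sw B.S ∧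
    e.snd ∈ B.graph.support B.nw B.N ∧ e.fst ∉ B.graph.support B.ne B.E with hq
  set f : Link VB DB → Link VB DB := fun e => if q e then e else e.flip with hf
  have hfe : ∀ e, f e = e ∨ f e = e.flip := fun e => by
    by_cases he : q e
    · exact Or.inl (if_pos he)
    · exact Or.inr (if_neg he)
  have hfX : ∀ e ∈ X, B.IsLink (f e) ∧ q (f e) := fun e he => by
    by_cases hqe : q e
    · rw [show f e = e from if_pos hqe]
      exact ⟨hX e he, hqe⟩
    · rw [show f e = e.flip from if_neg hqe]
      exact ⟨(hX e he).flip, (h e he).resolve_left hqe⟩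
  have key : ∀ g ∈ X.map f, B.IsLink g ∧ q g := fun g hg => by
    obtain ⟨e, he, rfl⟩ := Multiset.mem_map.1 hg
    exact hfX e he
  exact Replaceable.of_map hfe (replaceable_NS (fun g hg => (key g hg).1)
    (fun g hg => (key g hg).2.1) (fun g hg => (key g hg).2.2.1) fun g hg => (key g hg).2.2.2)

theorem replaceable_filter {c c' : ℕ} {X : Multiset (Link VB DB)} (q : Link VB DB → Prop)
    [DecidablePred q] (h : B.Replaceable c (X.filter q)) (h' : B.Replaceable c' (X.filter (¬ q ·))) :
    B.Replaceable (c + c') X := by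
  rw [← Multiset.filter_add_not q X]
  exact h.add h'

theorem replaceable_excursions {T : List D} {K : Multiset D} {X : Multiset (Link VB DB)}
    (hX : ∀ e ∈ X, B.IsExcursion e)
    (hT : (T : Multiset D) = K + (X.map Link.edges).sum.map B.dmap)
    (hE : B.crossings T B.ne B.E ≤ 2) (hW : B.crossings T B.sw B.W ≤ 2) :
    B.Replaceable (16 + 4 * B.k) X := by
  classical
  have hcE := card_filter_side_le hX hT (fun c hc => mem_boundary.2 (by tauto)) hE
  have hcW := card_filter_side_le hX hT (fun c hc => mem_boundary.2 (by tauto)) hW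
  -- Each of `E` and `W` has at most four excursions with two joining vertices each. They are split
  -- off first: replacement along `S` needs ends off `E`, and afterwards every end lies on `N` or
  -- `S`.
  refine Replaceable.mono (replaceable_filter (c := 8) (c' := 8 + (0 + (0 + 4 * B.k))) (fun e =>
    e.fst ∈ B.graph.support B.ne B.E ∨ e.snd ∈ B.graph.support B.ne B.E) ?_ <|
    replaceable_filter (fun e =>
      e.fst ∈ B.graph.support B.sw B.W ∨ e.snd ∈ B.graph.support B.sw B.W) ?_ <|
    replaceable_filter (fun e =>
      e.fst ∈ B.graph.support B.nw B.N ∧ e.snd ∈ B.graph.support B.nw B.N) ?_ <|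
    replaceable_filter (fun e =>
      e.fst ∈ B.graph.support B.sw B.S ∧ e.snd ∈ B.graph.support B.sw B.S) ?_ ?_) (by omega)
  · refine (replaceable_of_forall fun e he =>
      (hX e (Multiset.mem_filter.1 he).1).isLink.replaceable).mono (?_ : _ ≤ 2 * 4)
    exact Nat.mul_le_mul_left 2 hcE
  · refine (replaceable_of_forall fun e he =>
      (hX e (Multiset.mem_filter.1 (Multiset.mem_filter.1 he).1).1).isLink.replaceable).mono
        (?_ : _ ≤ 2 * 4)
    exact Nat.mul_le_mul_left 2 ((Multiset.card_le_card (Multiset.filter_le_filter _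
      (Multiset.filter_le _ X))).trans hcW)
  · refine (replaceable_of_forall (c := 0) fun e he => ?_).mono (by omega)
    simp only [Multiset.mem_filter] at he
    exact (hX e he.1.1.1).isLink.replaceable_N he.2.1 he.2.2
  · refine (replaceable_of_forall (c := 0) fun e he => ?_).mono (by omega)
    simp only [Multiset.mem_filter] at he
    exact (hX e he.1.1.1.1).isLink.replaceable_S he.2.1 he.2.2
      (fun h => he.1.1.1.2 (Or.inl h)) fun h => he.1.1.1.2 (Or.inr h)
  · refine replaceable_NS_of_or (fun e he => ?_) (fun e he => ?_)
    all_goals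
      simp only [Multiset.mem_filter] at he
      obtain ⟨⟨⟨⟨he, hE⟩, hW⟩, hN⟩, hS⟩ := he
    · exact (hX e he).isLink
    · have h1 := mem_sides_of_mem_boundaryVertices (hX e he).fst_mem
      have h2 := mem_sides_of_mem_boundaryVertices (hX e he).snd_mem
      clear hcE hcW hX hT
      push Not at hE hW
      replace h1 := ((h1.resolve_left hW.1).imp_right fun h => h.resolve_left hE.1)
      replace h2 := ((h2.resolve_left hW.2).imp_right fun h => h.resolve_left hE.2)
      rcases h1 with h1 | h1 <;> rcases h2 with h2 | h2
      · exact absurd ⟨h1, h2⟩ hN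
      · exact Or.inr ⟨h2, h1, hE.2⟩
      · exact Or.inl ⟨h1, h2, hE.1⟩
      · exact absurd ⟨h1, h2⟩ hS

/-- Although `vmap` may identify boundary vertices, parities push forward, so multisets with equal
parities in the brick have equal parities in `G`. -/
theorem oddChain_map (M : Multiset DB) :
    G.oddChain (M.map B.dmap) = (B.graph.oddChain M).mapDomain B.vmap := by
  induction M using Multiset.induction with
  | empty => simp [WGraph.oddChain_zero]
  | cons d M ih =>
    rw [Multiset.map_cons, WGraph.oddChain_cons, WGraph.oddChain_cons, Finsupp.mapDomain_add,
      Finsupp.mapDomain_add, Finsupp.mapDomain_single, Finsupp.mapDomain_single, ih, vmap_head,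
      vmap_tail]

theorem reach_map {M : Multiset DB} {x y : VB} (h : B.graph.Reach M x y) :
    G.Reach (M.map B.dmap) (B.vmap x) (B.vmap y) := by
  induction h with
  | rel a b h =>
    obtain ⟨d, hd, rfl, rfl⟩ := h
    rw [vmap_head, vmap_tail]
    exact WGraph.reach_of_mem (Multiset.mem_map_of_mem _ hd)
  | refl a => exact WGraph.Reach.refl ..
  | symm a b _ ih => exact ih.symm
  | trans a b c _ _ ih ih' => exact ih.trans ih'

theorem length_map (M : Multiset DB) : G.length (M.map B.dmap) = B.graph.length M := by
  simp only [WGraph.length, Multiset.map_map]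
  congr 1
  exact Multiset.map_congr rfl fun d _ => B.dmap_len d

end

/-- The edges of a tour strictly inside a brick can be replaced. -/
theorem exists_replacement (B : Brick G VB DB ε κ) {u : V} {T : List D} (hT : G.IsWalk u T u)
    (hE : B.crossings T B.ne B.E ≤ 2) (hW : B.crossings T B.sw B.W ≤ 2) :
    ∃ (K : Multiset D) (H H' : Multiset DB), (T : Multiset D) = K + H.map B.dmap ∧
      (∀ d ∈ K, d ∉ B.innerEdges) ∧ (∀ d ∈ H, B.Inner d) ∧
      (B.graph.joiningVertices H' B.boundary).ncard ≤ 16 + 4 * B.k ∧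
      B.graph.length H' ≤ (1 + 3 * ε) * B.graph.length H ∧
      ∃ (w : V) (T' : List D), G.IsWalk w T' w ∧
        (∀ d, G.mult T' d ≤ G.mult (K + H'.map B.dmap) d) ∧
        ∀ v ∈ B.boundaryVertices, B.vmap v ∈ G.support u T → B.vmap v ∈ G.support w T' := by
  classical
  by_cases ho : ∃ w ∈ G.support u T, B.Outer w
  · obtain ⟨w, hw, hwo⟩ := ho
    obtain ⟨L, hL, hLT, hsup⟩ := hT.exists_rotation hw
    obtain ⟨K, X, hX, hK, hdec, hr⟩ := B.exists_decomposition _ L rfl hL hwo hwo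
    obtain ⟨H', h1, h2, h3, h4⟩ := replaceable_excursions hX (hLT.symm.trans hdec) hE hW
    -- `H'` has the parities of the excursions it replaces, so the new multiset is even because the
    -- closed tour was.
    have hodd : G.oddChain (K + H'.map B.dmap) = 0 := by
      rw [WGraph.oddChain_add, oddChain_map, h1, ← oddChain_sum fun e he => (hX e he).isLink,
        ← oddChain_map, ← WGraph.oddChain_add, ← hdec, hL.oddChain, WGraph.chain_add_self]
    obtain ⟨T', hT', hmult, hreach⟩ := G.exists_euler_tour hodd w
    refine ⟨K, (X.map Link.edges).sum, H', hLT.symm.trans hdec, hK, fun d hd => ?_, h4,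
      by rwa [length_sum], w, T', hT', hmult, fun v hv hvT => hreach _ ?_⟩
    · obtain ⟨_, hm, hd⟩ := Multiset.mem_join.1 hd
      obtain ⟨e, he, rfl⟩ := Multiset.mem_map.1 hm
      exact (hX e he).inner d hd
    -- The decomposition connects the outer vertices of the tour under any equivalence relation that
    -- contains `K` and the pairs of excursion ends; the new multiset induces such a relation.
    · refine hr (G.Reach (K + H'.map B.dmap)) ⟨fun _ => WGraph.Reach.refl .., WGraph.Reach.symm,
        WGraph.Reach.trans⟩ (fun d hd => WGraph.reach_of_mem (Multiset.mem_add.2 (Or.inl hd)))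
        (fun e he => (reach_map (h2 e he)).mono (Multiset.subset_of_le (Multiset.le_add_left _ _)))
        _ (hsup _ hvT) (outer_of_mem hv)
  -- The whole tour stays strictly inside and visits no boundary vertex, so a one-vertex tour and an
  -- empty replacement suffice.
  · push Not at ho
    have hinner : ∀ d ∈ T, d ∈ B.innerEdges := by
      intro a ha
      have h := ho _ (hT.tail_mem ha)
      simp only [Outer, not_forall] at h
      obtain ⟨w, hw, hwb⟩ := h
      obtain ⟨d, hd, hda⟩ := B.star_inner w (fun d hd hdw => hwb ⟨d, hd, hdw⟩) a hw.symm
      refine ⟨d, ?_, hda⟩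
      by_contra h
      exact hwb (hd ▸ tail_mem_boundaryVertices h)
    obtain ⟨H, hH⟩ : T ∈ Set.range
        (List.map fun d : {d // B.Inner d} => B.dmap d.1) := by
      rw [Set.range_list_map]
      intro a ha
      obtain ⟨d, hd, h⟩ := hinner a ha
      exact ⟨⟨d, hd⟩, h⟩
    refine ⟨0, (H.map Subtype.val : List DB), 0, ?_, by simp, ?_, ?_, ?_, u, [], rfl, ?_, ?_⟩
    · rw [zero_add, Multiset.map_coe, List.map_map]
      exact congrArg _ hH.symm
    · intro d hd
      rw [Multiset.mem_coe, List.mem_map] at hd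
      obtain ⟨e, -, rfl⟩ := hd
      exact e.2
    · rw [joiningVertices_eq_empty B (by simp)]
      simp
    · simp [WGraph.length]
    · intro d
      simp [WGraph.mult]
    · intro v hv hvT
      exact absurd (outer_of_mem hv) (ho _ hvT)

end Brick

/-! ### The two readings of `H` -/

theorem mainTheorem6 {V D VB DB : Type*} [Finite VB] [Finite DB]
    (G : WGraph V D) (ε : ℝ≥0) (hε : 0 < ε) (κ : ℝ) (hκ : 1 ≤ κ)
    (B : Brick G VB DB ε κ)
    (u : V) (T : List D) (hT : G.IsWalk u T u)
    (hE : B.crossings T B.ne B.E ≤ 2) (hW : B.crossings T B.sw B.W ≤ 2)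
    (R : Set D) (hR : R = B.edges ∨ R = B.innerEdges)
    (H K : Multiset D)
    (hH : H = open Classical in (T : Multiset D).filter (fun d => d ∈ R))
    (hK : K = open Classical in (T : Multiset D).filter (fun d => d ∉ R)) :
    ∃ H' : Multiset DB,
      ((B.graph.joiningVertices H' B.boundary).ncard : ℝ) ≤ 6 * κ + 14 ∧
      B.graph.length H' ≤ (1 + 3 * ε) * G.length H ∧
      ∃ (w : V) (T' : List D), G.IsWalk w T' w ∧
        (∀ d, G.mult T' d ≤ G.mult (K + H'.map B.dmap) d) ∧
        ∀ v ∈ B.boundaryVertices, B.vmap v ∈ G.support u T → B.vmap v ∈ G.support w T' := by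
  classical
  obtain ⟨K₀, H₀, J, hdec, hK₀, hH₀, hjoin, hlen, hT'⟩ := B.exists_replacement hT hE hW
  have hsub : B.innerEdges ⊆ R := by
    rcases hR with rfl | rfl
    · rintro _ ⟨d, -, rfl⟩
      exact ⟨d, rfl⟩
    · exact subset_rfl
  have hRsub : R ⊆ B.edges := by
    rcases hR with rfl | rfl
    · exact subset_rfl
    · rintro _ ⟨d, -, rfl⟩
      exact ⟨d, rfl⟩
  -- The boundary edges of the tour that are counted in `H` are lifted to arbitrary copies and put
  -- back unchanged. They add no joining vertices, so both readings of `H` reduce to the replacement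
  -- of edges strictly inside.
  obtain ⟨F, hF⟩ : ∃ F : Multiset DB, F.map B.dmap = K₀.filter (· ∈ R) := by
    obtain ⟨L, hL⟩ := Quot.exists_rep (K₀.filter (· ∈ R))
    obtain ⟨F, hF⟩ : L ∈ Set.range (List.map B.dmap) := by
      rw [Set.range_list_map]
      intro a ha
      have : a ∈ K₀.filter (· ∈ R) := hL ▸ ha
      exact hRsub (Multiset.mem_filter.1 this).2
    exact ⟨F, by rw [← hL, Multiset.map_coe, hF]; rfl⟩
  have hFb : ∀ d ∈ F, ¬ B.Inner d := fun d hd hin => by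
    have h1 : B.dmap d ∈ K₀.filter (· ∈ R) := hF ▸ Multiset.mem_map_of_mem _ hd
    exact hK₀ _ (Multiset.mem_filter.1 h1).1 ⟨d, hin, rfl⟩
  have hH₀R : ∀ a ∈ H₀.map B.dmap, a ∈ R := fun a ha => by
    obtain ⟨d, hd, rfl⟩ := Multiset.mem_map.1 ha
    exact hsub ⟨d, hH₀ d hd, rfl⟩
  have hHeq : H = (F + H₀).map B.dmap := by
    rw [hH, hdec, Multiset.filter_add, Multiset.map_add, hF, Multiset.filter_eq_self.2 hH₀R]
  have hKeq : K + F.map B.dmap = K₀ := by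
    have h0 : (H₀.map B.dmap).filter (· ∉ R) = 0 :=
      Multiset.filter_eq_nil.2 fun a ha h => h (hH₀R a ha)
    rw [hK, hdec, Multiset.filter_add, h0, add_zero, hF, add_comm, Multiset.filter_add_not]
  refine ⟨F + J, ?_, ?_, ?_⟩
  · rw [B.joiningVertices_add, B.joiningVertices_eq_empty hFb, Set.empty_union]
    -- The bound `16 + 4k ≤ 6κ + 14` uses `1 ≤ κ` as well as `k ≤ κ`.
    have h1 : ((B.graph.joiningVertices J B.boundary).ncard : ℝ) ≤ 16 + 4 * B.k := by
      exact_mod_cast hjoin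
    have := B.k_le
    linarith
  · rw [hHeq, Brick.length_map, WGraph.length_add, WGraph.length_add, mul_add]
    exact add_le_add (le_mul_of_one_le_left' le_self_add) hlen
  · rw [Multiset.map_add, ← add_assoc, hKeq]
    exact hT'
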